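/- Let $k\ge 0$ and let $\Lambda$ be a $k$-graph with degree functor $d$ that is finite (each $\Lambda^n=d^{-1}(n)$, $n\in\mathbb N^k$, is finite) and has no sources ($v\Lambda^n\neq\emptyset$ for all vertices $v\in\Lambda^0$ and all $n\in\mathbb N^k$). Let $A_i$, $1\le i\le k$, be the vertex matrices, $A_i(v,w)=|v\Lambda^{e_i}w|$, the number of paths of degree $e_i$ with range $v$ and source $w$. A Toeplitz–Cuntz–Krieger $\Lambda$-family in a $C^*$-algebra consists of partial isometries $\{T_\lambda:\lambda\in\Lambda\}$ such that the $Q_v:=T_v$ ($v\in\Lambda^0$) are mutually orthogonal projections; $T_\lambda T_\mu=T_{\lambda\mu}$ whenever the source $s(\lambda)$ of $\lambda$ is the range of $\mu$; $T_\lambda^*T_\lambda=Q_{s(\lambda)}$; $Q_v\ge\sum_{\lambda\in v\Lambda^n}T_\lambda T_\lambda^*$ for all $v\in\Lambda^0$, $n\in\mathbb N^k$; and $T_\mu^*T_\nu=\sum T_\eta T_\zeta^*$, where the sum is over all pairs $(\eta,\zeta)$ with $\mu\eta=\nu\zeta$ and $d(\mu\eta)=d(\mu)\vee d(\nu)$.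 It is a Cuntz–Krieger family if in addition $Q_v=\sum_{\lambda\in v\Lambda^n}T_\lambda T_\lambda^*$ for all $v$ and $n$. Let $\mathcal TC^*(\Lambda)$ be the $C^*$-algebra generated by a universal Toeplitz–Cuntz–Krieger family $\{t_\lambda,q_v\}$, let $C^*(\Lambda)$ be the $C^*$-algebra generated by a universal Cuntz–Krieger family, and let $\pi:\mathcal TC^*(\Lambda)\to C^*(\Lambda)$ be the canonical homomorphism. Let $\gamma$ be the gauge action of $\mathbb T^k$ on $\mathcal TC^*(\Lambda)$, $\gamma_z(t_\lambda)=z^{d(\lambda)}t_\lambda$; fix $r=(r_1,\dots,r_k)\in(0,\infty)^k$ and put $\alpha_t=\gamma_{e^{itr}}$ for $t\in\mathbb R$. Let $\beta\in[0,\infty)$ and let $\phi$ be a KMS$_\beta$ state of $(\mathcal TC^*(\Lambda),\alpha)$: a state such that, for $\beta>0$, $\phi(ab)=\phi(b\,\alpha_{i\beta}(a))$ for all $\alpha$-analytic $a,b$ (those $a$ for which $t\mapsto\alpha_t(a)$ extends to an entire function $z\mapsto\alpha_z(a)$), and, for $\beta=0$, such that $\phi$ is an $\alpha$-invariant trace.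 Define $m^\phi=(m_v)_{v\in\Lambda^0}$ by $m_v=\phi(q_v)$. (a) $m^\phi\in[0,1]^{\Lambda^0}$ is a probability measure on $\Lambda^0$, i.e. $\sum_v m_v=1$, and for every subset $K\subseteq\{1,\dots,k\}$ we have $\prod_{i\in K}(1-e^{-\beta r_i}A_i)\,m^\phi\ge 0$ pointwise (the matrices $A_i$ commute). (b) $\phi$ factors through $C^*(\Lambda)$, i.e. $\phi=\psi\circ\pi$ for some state $\psi$ of $C^*(\Lambda)$, if and only if $A_i m^\phi=e^{\beta r_i}m^\phi$ for every $1\le i\le k$. -/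

import Mathlib

open CategoryTheory
open scoped ENNReal ComplexOrder

universe u

/-- A `k`-graph: a small category with a degree functor to the monoid `ℕ^k` that has the
factorisation property.  A morphism `f : v ⟶ w` is a path with source `v` and range `w`, and the
composite `f ≫ g` is the path that is written `g f` in the higher-rank graph literature. -/
structure KGraph (k : ℕ) : Type (u + 1) where
  Vertex : Type u
  [category : SmallCategory Vertex]
  degree : ∀ {v w : Vertex}, (v ⟶ w) → (Fin k → ℕ)
  degree_id : ∀ v : Vertex, degree (𝟙 v) = 0
  degree_comp : ∀ {v w x : Vertex} (f : v ⟶ w) (g : w ⟶ x),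
    degree (f ≫ g) = degree g + degree f
  factorisation : ∀ {v x : Vertex} (f : v ⟶ x) (m n : Fin k → ℕ), degree f = m + n →
    ∃! p : Σ w : Vertex, (v ⟶ w) × (w ⟶ x),
      degree p.2.2 = m ∧ degree p.2.1 = n ∧ p.2.1 ≫ p.2.2 = f

namespace KGraph

variable {k : ℕ} (Λ : KGraph.{u} k)

instance : SmallCategory Λ.Vertex := Λ.category

/-- The paths (the morphisms) of a `k`-graph. -/
structure Path where
  source : Λ.Vertex
  range : Λ.Vertex
  hom : source ⟶ range

variable {Λ}

namespace Path

/-- The degree `d(μ)` of a path. -/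
def deg (μ : Λ.Path) : Fin k → ℕ := Λ.degree μ.hom

/-- The vertex `v`, as a path of degree `0`. -/
def vertex (v : Λ.Vertex) : Λ.Path := ⟨v, v, 𝟙 v⟩

/-- The composite `μν` of paths with `s(μ) = r(ν)`. -/
def comp (μ ν : Λ.Path) (h : μ.source = ν.range) : Λ.Path :=
  ⟨ν.source, μ.range, ν.hom ≫ eqToHom h.symm ≫ μ.hom⟩

theorem deg_comp (μ ν : Λ.Path) (h : μ.source = ν.range) :
    (μ.comp ν h).deg = μ.deg + ν.deg := by
  obtain ⟨a, b, f⟩ := μ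
  obtain ⟨c, d, g⟩ := ν
  obtain rfl : a = d := h
  simp [comp, deg, Λ.degree_comp]

end Path

variable (Λ)

/-- A `k`-graph is finite if it has finitely many paths of each degree. -/
class IsFinite : Prop where
  finite_deg : ∀ n : Fin k → ℕ, {μ : Λ.Path | μ.deg = n}.Finite

/-- A `k`-graph has no sources if `vΛ^n` is nonempty for all vertices `v` and all `n ∈ ℕ^k`. -/
def NoSources : Prop :=
  ∀ (v : Λ.Vertex) (n : Fin k → ℕ), ∃ μ : Λ.Path, μ.range = v ∧ μ.deg = n

theorem finite_pathsTo [Λ.IsFinite] (v : Λ.Vertex) (n : Fin k → ℕ) :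
    {μ : Λ.Path | μ.range = v ∧ μ.deg = n}.Finite :=
  (IsFinite.finite_deg n).subset fun _ h => h.2

variable {Λ}

/-- The set `vΛ^n` of paths of degree `n` with range `v`. -/
noncomputable def pathsTo [Λ.IsFinite] (v : Λ.Vertex) (n : Fin k → ℕ) : Finset Λ.Path :=
  (Λ.finite_pathsTo v n).toFinset

/-- The set `Λ^min(μ, ν)` of pairs `(η, ζ)` with `μη = νζ` and `d(μη) = d(μ) ∨ d(ν)`. -/
def minExtSet (μ ν : Λ.Path) : Set (Λ.Path × Λ.Path) :=
  {p | ∃ (h₁ : μ.source = p.1.range) (h₂ : ν.source = p.2.range),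
    μ.comp p.1 h₁ = ν.comp p.2 h₂ ∧ (μ.comp p.1 h₁).deg = μ.deg ⊔ ν.deg}

theorem finite_minExtSet [Λ.IsFinite] (μ ν : Λ.Path) : (minExtSet μ ν).Finite := by
  refine ((IsFinite.finite_deg (μ.deg ⊔ ν.deg - μ.deg)).prod
    (IsFinite.finite_deg (μ.deg ⊔ ν.deg - ν.deg))).subset ?_
  rintro ⟨η, ζ⟩ ⟨h₁, h₂, h, hd⟩
  have hd' := hd
  rw [h, Path.deg_comp] at hd'
  rw [Path.deg_comp] at hd
  refine ⟨?_, ?_⟩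
  · change η.deg = _
    rw [← hd, add_tsub_cancel_left]
  · change ζ.deg = _
    rw [← hd', add_tsub_cancel_left]

/-- `Λ^min(μ, ν)` as a finite set. -/
noncomputable def minExt [Λ.IsFinite] (μ ν : Λ.Path) : Finset (Λ.Path × Λ.Path) :=
  (finite_minExtSet μ ν).toFinset

/-! ### Vertex matrices -/

variable (Λ)

/-- The vertex matrix `A_i`, with entries `A_i(v, w) = |vΛ^{e_i}w|`. -/
noncomputable def vertexMatrix (i : Fin k) : Matrix Λ.Vertex Λ.Vertex ℝ :=
  Matrix.of fun v w => (Nat.card {f : w ⟶ v // Λ.degree f = Pi.single i 1} : ℝ)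

theorem finite_hom [Λ.IsFinite] (v w : Λ.Vertex) (n : Fin k → ℕ) :
    Finite {f : w ⟶ v // Λ.degree f = n} := by
  have := (IsFinite.finite_deg (Λ := Λ) n).to_subtype
  refine Finite.of_injective
    (fun f => (⟨⟨w, v, f.1⟩, f.2⟩ : {μ : Λ.Path | μ.deg = n})) fun f g h => ?_
  simpa [Subtype.ext_iff] using h

theorem vertexMatrix_mul [Fintype Λ.Vertex] [Λ.IsFinite] (i j : Fin k) (v w : Λ.Vertex) :
    (Λ.vertexMatrix i * Λ.vertexMatrix j) v w =
      (Nat.card {f : w ⟶ v // Λ.degree f = Pi.single i 1 + Pi.single j 1} : ℝ) := by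
  have := Λ.finite_hom
  have e : (Σ u : Λ.Vertex, {f : u ⟶ v // Λ.degree f = Pi.single i 1} ×
      {f : w ⟶ u // Λ.degree f = Pi.single j 1}) ≃
      {f : w ⟶ v // Λ.degree f = Pi.single i 1 + Pi.single j 1} := by
    refine Equiv.ofBijective
      (fun p => ⟨p.2.2.1 ≫ p.2.1.1, by rw [Λ.degree_comp, p.2.1.2, p.2.2.2]⟩) ⟨?_, ?_⟩
    · rintro ⟨a, ⟨f, hf⟩, ⟨g, hg⟩⟩ ⟨b, ⟨f', hf'⟩, ⟨g', hg'⟩⟩ h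
      have h' : g ≫ f = g' ≫ f' := congrArg Subtype.val h
      have key := (Λ.factorisation (g ≫ f) _ _
        (by rw [Λ.degree_comp, hf, hg])).unique
        (y₁ := ⟨a, g, f⟩) (y₂ := ⟨b, g', f'⟩) ⟨hf, hg, rfl⟩ ⟨hf', hg', h'.symm⟩
      cases key
      rfl
    · rintro ⟨f, hf⟩
      obtain ⟨⟨a, g, g'⟩, ⟨h₁, h₂, h₃⟩, -⟩ := Λ.factorisation f _ _ hf
      exact ⟨⟨a, ⟨g', h₁⟩, ⟨g, h₂⟩⟩, Subtype.ext h₃⟩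
  rw [← Nat.card_congr e, Nat.card_sigma, Matrix.mul_apply]
  simp [vertexMatrix, Nat.card_prod]

theorem vertexMatrix_commute [Fintype Λ.Vertex] [Λ.IsFinite] (i j : Fin k) :
    Commute (Λ.vertexMatrix i) (Λ.vertexMatrix j) := by
  ext v w
  rw [vertexMatrix_mul, vertexMatrix_mul, add_comm]

/-- The product `∏_{i ∈ K} (1 - e^{-β r_i} A_i)` of commuting matrices. -/
noncomputable def subinvarianceProd [Fintype Λ.Vertex] [DecidableEq Λ.Vertex] [Λ.IsFinite]
    (r : Fin k → ℝ) (β : ℝ) (K : Finset (Fin k)) : Matrix Λ.Vertex Λ.Vertex ℝ :=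
  K.noncommProd (fun i => 1 - Real.exp (-(β * r i)) • Λ.vertexMatrix i) fun i _ j _ _ =>
    (Commute.one_left _).sub_left <| (Commute.one_right _).sub_right <|
      ((Λ.vertexMatrix_commute i j).smul_left _).smul_right _

/-! ### Toeplitz-Cuntz-Krieger families and their universal C⋆-algebras -/

variable {Λ}

/-- A Toeplitz-Cuntz-Krieger `Λ`-family in a C⋆-algebra `B`; the projection `Q_v` is
`T (.vertex v)`, and `a ≥ b` is expressed by `a - b = c⋆ c`. -/
structure IsTCKFamily [Λ.IsFinite] {B : Type*} [NonUnitalCStarAlgebra B] (T : Λ.Path → B) :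
    Prop where
  partialIsometry : ∀ μ, T μ * star (T μ) * T μ = T μ
  projection : ∀ v, IsStarProjection (T (.vertex v))
  orthogonal : ∀ v w, v ≠ w → T (.vertex v) * T (.vertex w) = 0
  map_comp : ∀ (μ ν : Λ.Path) (h : μ.source = ν.range), T μ * T ν = T (μ.comp ν h)
  star_mul_self : ∀ μ, star (T μ) * T μ = T (.vertex μ.source)
  sum_le : ∀ (v : Λ.Vertex) (n : Fin k → ℕ),
    ∃ c : B, T (.vertex v) - ∑ μ ∈ pathsTo v n, T μ * star (T μ) = star c * c
  star_mul : ∀ μ ν : Λ.Path, star (T μ) * T ν = ∑ p ∈ minExt μ ν, T p.1 * star (T p.2)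

/-- The additional Cuntz-Krieger relation. -/
def IsCK [Λ.IsFinite] {B : Type*} [NonUnitalCStarAlgebra B] (T : Λ.Path → B) : Prop :=
  ∀ (v : Λ.Vertex) (n : Fin k → ℕ), T (.vertex v) = ∑ μ ∈ pathsTo v n, T μ * star (T μ)

variable (Λ)

/-- A C⋆-algebra together with a Toeplitz-Cuntz-Krieger `Λ`-family in it. -/
structure TCKRep [Λ.IsFinite] : Type (u + 1) where
  B : Type u
  [cstar : NonUnitalCStarAlgebra B]
  T : Λ.Path → B
  isTCK : IsTCKFamily T

attribute [instance] TCKRep.cstar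

variable {Λ}

theorem comp_left_cancel {μ ν η ζ : Λ.Path} (h₁ : μ.source = η.range) (h₂ : ν.source = ζ.range)
    (h : μ.comp η h₁ = ν.comp ζ h₂) (hd : μ.deg = ν.deg) : μ = ν := by
  have hdd := congrArg Path.deg h
  rw [Path.deg_comp, Path.deg_comp, hd, add_right_inj] at hdd
  obtain ⟨a, b, f⟩ := μ
  obtain ⟨a', b', f'⟩ := ν
  obtain ⟨c, d, g⟩ := η
  obtain ⟨c', d', g'⟩ := ζ
  obtain rfl : a = d := h₁
  obtain rfl : a' = d' := h₂
  simp only [Path.comp, eqToHom_refl, Category.id_comp, Path.mk.injEq] at h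
  obtain ⟨rfl, rfl, h⟩ := h
  have h' := eq_of_heq h
  have key := (Λ.factorisation (g ≫ f) _ _ (Λ.degree_comp g f)).unique
    (y₁ := ⟨a, g, f⟩) (y₂ := ⟨a', g', f'⟩) ⟨rfl, rfl, rfl⟩ ⟨hd.symm, hdd.symm, h'.symm⟩
  cases key
  rfl

theorem vertex_comp (μ : Λ.Path) : (Path.vertex μ.range).comp μ rfl = μ := by
  simp [Path.comp, Path.vertex]

theorem deg_vertex (v : Λ.Vertex) : (Path.vertex v).deg = 0 := Λ.degree_id v

variable [Λ.IsFinite]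

theorem IsTCKFamily.norm_le_one {B : Type*} [NonUnitalCStarAlgebra B] {T : Λ.Path → B}
    (hT : IsTCKFamily T) (μ : Λ.Path) : ‖T μ‖ ≤ 1 := by
  have h := IsStarProjection.norm_le _ (hT.projection μ.source)
  rw [← hT.star_mul_self, CStarRing.norm_star_mul_self] at h
  nlinarith [norm_nonneg (T μ)]

theorem IsTCKFamily.defect_sq {B : Type*} [NonUnitalCStarAlgebra B] {T : Λ.Path → B}
    (hT : IsTCKFamily T) (v : Λ.Vertex) (n : Fin k → ℕ) :
    T (.vertex v) - ∑ μ ∈ pathsTo v n, T μ * star (T μ) =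
      star (T (.vertex v) - ∑ μ ∈ pathsTo v n, T μ * star (T μ)) *
        (T (.vertex v) - ∑ μ ∈ pathsTo v n, T μ * star (T μ)) := by
  have hmem : ∀ μ ∈ pathsTo v n, μ.range = v ∧ μ.deg = n := fun μ hμ => by
    simpa [pathsTo] using hμ
  have hQ : ∀ μ ∈ pathsTo v n, T (.vertex v) * T μ = T μ := fun μ hμ => by
    obtain ⟨rfl, -⟩ := hmem μ hμ
    rw [hT.map_comp _ _ rfl, vertex_comp]
  have hQs : star (T (.vertex v)) = T (.vertex v) := (hT.projection v).isSelfAdjoint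
  have hQQ : T (.vertex v) * T (.vertex v) = T (.vertex v) := (hT.projection v).isIdempotentElem
  have hort : ∀ μ ∈ pathsTo v n, ∀ ν ∈ pathsTo v n, μ ≠ ν → star (T μ) * T ν = 0 := by
    intro μ hμ ν hν hne
    rw [hT.star_mul, Finset.sum_eq_zero]
    rintro ⟨η, ζ⟩ hp
    obtain ⟨h₁, h₂, h, -⟩ : (η, ζ) ∈ minExtSet μ ν := by simpa [minExt] using hp
    exact absurd (comp_left_cancel h₁ h₂ h ((hmem μ hμ).2.trans (hmem ν hν).2.symm)) hne
  set P := ∑ μ ∈ pathsTo v n, T μ * star (T μ) with hP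
  have hPs : star P = P := by simp [hP]
  have hQP : T (.vertex v) * P = P := by
    rw [hP, Finset.mul_sum]
    exact Finset.sum_congr rfl fun μ hμ => by rw [← mul_assoc, hQ μ hμ]
  have hPQ : P * T (.vertex v) = P := by
    have := congrArg star hQP
    rwa [StarMul.star_mul, hPs, hQs] at this
  have hPP : P * P = P := by
    conv_lhs => rw [hP, Finset.sum_mul_sum]
    rw [hP]
    refine Finset.sum_congr rfl fun μ hμ => ?_
    rw [Finset.sum_eq_single_of_mem μ hμ]
    · rw [← mul_assoc, hT.partialIsometry]
    · intro ν hν hne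
      rw [mul_assoc, ← mul_assoc (star (T μ)), hort μ hμ ν hν hne.symm, zero_mul, mul_zero]
  rw [star_sub, hPs, hQs, sub_mul, mul_sub, mul_sub, hQQ, hQP, hPQ, hPP, sub_self, sub_zero]

/-- The bounded sections over a class `S` of Toeplitz-Cuntz-Krieger families. -/
abbrev Ambient (S : Set Λ.TCKRep) : Type (u + 1) := lp (fun i : S => i.1.B) ∞

/-- The family `λ ↦ (T_λ)` that is formed by all the families in `S` simultaneously. -/
noncomputable def ambientGen (S : Set Λ.TCKRep) (μ : Λ.Path) : Ambient S :=
  ⟨fun i => i.1.T μ, memℓp_infty ⟨1, by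
    rintro _ ⟨i, rfl⟩
    exact i.1.isTCK.norm_le_one μ⟩⟩

/-- The C⋆-subalgebra of the bounded sections that is generated by the family `ambientGen S`. -/
noncomputable def univSubalgebra (S : Set Λ.TCKRep) : NonUnitalStarSubalgebra ℂ (Ambient S) :=
  (NonUnitalStarAlgebra.adjoin ℂ (Set.range (ambientGen S))).topologicalClosure

instance (S : Set Λ.TCKRep) : IsClosed (univSubalgebra S : Set (Ambient S)) :=
  NonUnitalStarSubalgebra.isClosed_topologicalClosure _

/-- The universal C⋆-algebra for the families in the class `S`. -/
abbrev UnivAlg (S : Set Λ.TCKRep) : Type (u + 1) := univSubalgebra S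

/-- The generating family of the universal C⋆-algebra. -/
noncomputable def univGen (S : Set Λ.TCKRep) (μ : Λ.Path) : UnivAlg S :=
  ⟨ambientGen S μ, NonUnitalStarSubalgebra.le_topologicalClosure _
    (NonUnitalStarAlgebra.subset_adjoin ℂ _ ⟨μ, rfl⟩)⟩

/-- Evaluation at a family `i ∈ S`: the representation of the universal algebra given by `i`. -/
noncomputable def evalHom (S : Set Λ.TCKRep) (i : S) : UnivAlg S →⋆ₙₐ[ℂ] i.1.B where
  toFun x := x.1 i
  map_smul' _ _ := rfl
  map_zero' := rfl
  map_add' _ _ := rfl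
  map_mul' _ _ := rfl
  map_star' _ := rfl

@[simp]
theorem evalHom_univGen (S : Set Λ.TCKRep) (i : S) (μ : Λ.Path) :
    evalHom S i (univGen S μ) = i.1.T μ := rfl

theorem UnivAlg.ext_eval {S : Set Λ.TCKRep} {x y : UnivAlg S}
    (h : ∀ i, evalHom S i x = evalHom S i y) : x = y :=
  Subtype.ext (lp.ext (funext h))

open scoped CStarAlgebra in
/-- A homomorphism on the universal algebra is determined by its values on the generators. -/
theorem UnivAlg.hom_ext {S : Set Λ.TCKRep} {C : Type*} [NonUnitalCStarAlgebra C]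
    {f g : UnivAlg S →⋆ₙₐ[ℂ] C} (h : ∀ μ, f (univGen S μ) = g (univGen S μ)) : f = g := by
  have hf : Continuous f := map_continuous f
  have hg : Continuous g := map_continuous g
  have key : ∀ x (hx : x ∈ NonUnitalStarAlgebra.adjoin ℂ (Set.range (ambientGen S))),
      f ⟨x, NonUnitalStarSubalgebra.le_topologicalClosure _ hx⟩ =
        g ⟨x, NonUnitalStarSubalgebra.le_topologicalClosure _ hx⟩ := by
    intro x hx
    induction hx using NonUnitalStarAlgebra.adjoin_induction with
    | mem x hx => obtain ⟨μ, rfl⟩ := hx; exact h μ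
    | add x y hx hy ihx ihy =>
      exact (map_add f ⟨x, _⟩ ⟨y, _⟩).trans ((congrArg₂ _ ihx ihy).trans
        (map_add g ⟨x, _⟩ ⟨y, _⟩).symm)
    | zero => exact (map_zero f).trans (map_zero g).symm
    | mul x y hx hy ihx ihy =>
      exact (map_mul f ⟨x, _⟩ ⟨y, _⟩).trans ((congrArg₂ _ ihx ihy).trans
        (map_mul g ⟨x, _⟩ ⟨y, _⟩).symm)
    | smul c x hx ih =>
      exact (map_smul f c ⟨x, _⟩).trans ((congrArg _ ih).trans (map_smul g c ⟨x, _⟩).symm)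
    | star x hx ih =>
      exact (map_star f ⟨x, _⟩).trans ((congrArg _ ih).trans (map_star g ⟨x, _⟩).symm)
  ext ⟨x, hx⟩
  have hx' : x ∈ closure
      (NonUnitalStarAlgebra.adjoin ℂ (Set.range (ambientGen S)) : Set (Ambient S)) := hx
  have hmem : (⟨x, hx⟩ : UnivAlg S) ∈ closure
      {y : UnivAlg S | y.1 ∈ NonUnitalStarAlgebra.adjoin ℂ (Set.range (ambientGen S))} := by
    rw [closure_subtype]
    convert hx' using 2
    ext y
    constructor
    · rintro ⟨z, hz, rfl⟩; exact hz
    · intro hy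
      exact ⟨⟨y, NonUnitalStarSubalgebra.le_topologicalClosure _ hy⟩, hy, rfl⟩
  exact closure_minimal (fun y hy => key y.1 hy) (isClosed_eq hf hg) hmem

/-- The generators of the universal algebra form a Toeplitz-Cuntz-Krieger family. -/
theorem isTCKFamily_univGen (S : Set Λ.TCKRep) : IsTCKFamily (univGen S) where
  partialIsometry μ := UnivAlg.ext_eval fun i => by
    simpa [map_star] using i.1.isTCK.partialIsometry μ
  projection v := by
    refine ⟨UnivAlg.ext_eval fun i => ?_, UnivAlg.ext_eval fun i => ?_⟩
    · simpa using (i.1.isTCK.projection v).isIdempotentElem.eq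
    · simpa [map_star] using (i.1.isTCK.projection v).isSelfAdjoint.star_eq
  orthogonal v w h := UnivAlg.ext_eval fun i => by
    simpa using i.1.isTCK.orthogonal v w h
  map_comp μ ν h := UnivAlg.ext_eval fun i => by
    simpa using i.1.isTCK.map_comp μ ν h
  star_mul_self μ := UnivAlg.ext_eval fun i => by
    simpa [map_star] using i.1.isTCK.star_mul_self μ
  sum_le v n := ⟨univGen S (.vertex v) - ∑ μ ∈ pathsTo v n, univGen S μ * star (univGen S μ),
    UnivAlg.ext_eval fun i => by
      rw [map_mul, map_star, map_sub, map_sum]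
      simpa [map_star] using i.1.isTCK.defect_sq v n⟩
  star_mul μ ν := UnivAlg.ext_eval fun i => by
    simpa [map_star] using i.1.isTCK.star_mul μ ν

/-- The universal property. -/
theorem UnivAlg.existsUnique_hom (S : Set Λ.TCKRep) (i : Λ.TCKRep) (hi : i ∈ S) :
    ∃! f : UnivAlg S →⋆ₙₐ[ℂ] i.B, ∀ μ, f (univGen S μ) = i.T μ :=
  ⟨evalHom S ⟨i, hi⟩, fun _ => rfl, fun _ hg => UnivAlg.hom_ext hg⟩

open scoped CStarAlgebra in
/-- A homomorphism of algebras of bounded sections that maps generators into the universal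
algebra restricts to the universal algebras. -/
noncomputable def restrictAmbient {S S' : Set Λ.TCKRep} (F : Ambient S →⋆ₙₐ[ℂ] Ambient S')
    (hF : ∀ μ, F (ambientGen S μ) ∈ univSubalgebra S') : UnivAlg S →⋆ₙₐ[ℂ] UnivAlg S' :=
  NonUnitalStarAlgHom.codRestrict
    (F.comp (NonUnitalStarSubalgebraClass.subtype (univSubalgebra S))) (univSubalgebra S') <| by
      have hle : univSubalgebra S ≤ (univSubalgebra S').comap F := by
        refine NonUnitalStarSubalgebra.topologicalClosure_minimal _ ?_ ?_
        · refine NonUnitalStarAlgebra.adjoin_le ?_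
          rintro _ ⟨μ, rfl⟩
          exact hF μ
        · exact IsClosed.preimage (map_continuous F)
            (NonUnitalStarSubalgebra.isClosed_topologicalClosure _)
      exact fun x => hle x.2

/-- The canonical homomorphism from the universal algebra of a class of families to that of a
smaller class; it maps generators to generators. -/
noncomputable def restrictHom {S S' : Set Λ.TCKRep} (h : S' ⊆ S) :
    UnivAlg S →⋆ₙₐ[ℂ] UnivAlg S' :=
  restrictAmbient
    { toFun x := ⟨fun i => x ⟨i.1, h i.2⟩, memℓp_infty ⟨‖x‖, by
        rintro _ ⟨i, rfl⟩
        exact lp.norm_apply_le_norm ENNReal.top_ne_zero x _⟩⟩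
      map_smul' _ _ := rfl
      map_zero' := rfl
      map_add' _ _ := rfl
      map_mul' _ _ := rfl
      map_star' _ := rfl }
    fun μ => (univGen S' μ).2

theorem restrictHom_univGen {S S' : Set Λ.TCKRep} (h : S' ⊆ S) (μ : Λ.Path) :
    restrictHom h (univGen S μ) = univGen S' μ := rfl

variable (Λ)

/-- The Toeplitz algebra of `Λ`: the universal C⋆-algebra for Toeplitz-Cuntz-Krieger families. -/
abbrev Toeplitz : Type (u + 1) := UnivAlg (Set.univ : Set Λ.TCKRep)

/-- The graph algebra `C⋆(Λ)`: the universal C⋆-algebra for Cuntz-Krieger families. -/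
abbrev GraphAlg : Type (u + 1) := UnivAlg {i : Λ.TCKRep | IsCK i.T}

/-- The canonical homomorphism of the Toeplitz algebra onto the graph algebra. -/
noncomputable def toGraphAlg : Λ.Toeplitz →⋆ₙₐ[ℂ] Λ.GraphAlg :=
  restrictHom (Set.subset_univ _)

variable {Λ}

/-- The universal Toeplitz-Cuntz-Krieger family `t_μ`. -/
noncomputable def t (μ : Λ.Path) : Λ.Toeplitz := univGen _ μ

/-- The vertex projections `q_v = t_v`. -/
noncomputable def q (v : Λ.Vertex) : Λ.Toeplitz := t (.vertex v)

/-- The generators of the graph algebra form a Cuntz-Krieger family. -/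
theorem isCK_univGen : IsCK (univGen {i : Λ.TCKRep | IsCK i.T}) :=
  fun v n => UnivAlg.ext_eval fun i => by simpa [map_star] using i.2 v n

/-! ### The gauge action -/

/-- The monomial `z^n = ∏_j z_j^{n_j}` for `z ∈ 𝕋^k`. -/
noncomputable def monomial (z : Fin k → Circle) (n : Fin k → ℕ) : Circle := ∏ j, z j ^ n j

theorem monomial_add (z : Fin k → Circle) (m n : Fin k → ℕ) :
    monomial z (m + n) = monomial z m * monomial z n := by
  simp [monomial, pow_add, Finset.prod_mul_distrib]

theorem monomial_mul (z w : Fin k → Circle) (n : Fin k → ℕ) :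
    monomial (z * w) n = monomial z n * monomial w n := by
  simp [monomial, mul_pow, Finset.prod_mul_distrib]

theorem monomial_smul_mul_star {B : Type*} [NonUnitalCStarAlgebra B] (c d : Circle) (a b : B) :
    ((c : ℂ) • a) * star ((d : ℂ) • b) = ((c * d⁻¹ : Circle) : ℂ) • (a * star b) := by
  rw [star_smul, smul_mul_smul_comm, Circle.coe_mul, Circle.coe_inv_eq_conj]
  rfl

theorem monomial_star_smul_mul {B : Type*} [NonUnitalCStarAlgebra B] (c d : Circle) (a b : B) :
    star ((c : ℂ) • a) * ((d : ℂ) • b) = ((c⁻¹ * d : Circle) : ℂ) • (star a * b) := by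
  rw [star_smul, smul_mul_smul_comm, Circle.coe_mul, Circle.coe_inv_eq_conj]
  rfl

/-- If `T` is a Toeplitz-Cuntz-Krieger family, then so is `μ ↦ z^{d(μ)} T_μ`. -/
theorem IsTCKFamily.twist {B : Type*} [NonUnitalCStarAlgebra B] {T : Λ.Path → B}
    (hT : IsTCKFamily T) (z : Fin k → Circle) :
    IsTCKFamily fun μ => (monomial z μ.deg : ℂ) • T μ := by
  have hv : ∀ v : Λ.Vertex, (monomial z (Path.vertex v).deg : ℂ) • T (.vertex v) =
      T (.vertex v) := fun v => by simp [deg_vertex, monomial]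
  refine ⟨fun μ => ?_, fun v => ?_, fun v w h => ?_, fun μ ν h => ?_, fun μ => ?_,
    fun v n => ?_, fun μ ν => ?_⟩
  · rw [monomial_smul_mul_star, mul_inv_cancel, Circle.coe_one, one_smul, mul_smul_comm,
      hT.partialIsometry]
  · simpa only [hv] using hT.projection v
  · simpa only [hv] using hT.orthogonal v w h
  · rw [Path.deg_comp, monomial_add, Circle.coe_mul, smul_mul_smul_comm, hT.map_comp μ ν h]
  · simp only [hv]
    rw [monomial_star_smul_mul, inv_mul_cancel, Circle.coe_one, one_smul, hT.star_mul_self]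
  · simp only [hv]
    obtain ⟨c, hc⟩ := hT.sum_le v n
    refine ⟨c, ?_⟩
    rw [← hc]
    simp only [monomial_smul_mul_star, mul_inv_cancel, Circle.coe_one, one_smul]
  · rw [monomial_star_smul_mul, hT.star_mul, Finset.smul_sum]
    refine Finset.sum_congr rfl ?_
    rintro ⟨η, ζ⟩ hp
    obtain ⟨h₁, h₂, h, -⟩ : (η, ζ) ∈ minExtSet μ ν := by simpa [minExt] using hp
    have hd := congrArg (fun κ : Λ.Path => monomial z κ.deg) h
    simp only [Path.deg_comp, monomial_add] at hd
    have hc : (monomial z μ.deg)⁻¹ * monomial z ν.deg =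
        monomial z η.deg * (monomial z ζ.deg)⁻¹ := by
      rw [inv_mul_eq_iff_eq_mul, ← mul_assoc, eq_mul_inv_iff_mul_eq, hd]
    rw [monomial_smul_mul_star, hc]

/-- The family `μ ↦ z^{d(μ)} T_μ` in the same C⋆-algebra. -/
noncomputable def TCKRep.twist (z : Fin k → Circle) (i : Λ.TCKRep) : Λ.TCKRep where
  B := i.B
  T μ := (monomial z μ.deg : ℂ) • i.T μ
  isTCK := i.isTCK.twist z

/-- The endomorphism `γ_z` of the Toeplitz algebra with `γ_z(t_μ) = z^{d(μ)} t_μ`. -/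
noncomputable def gaugeHom (z : Fin k → Circle) : Λ.Toeplitz →⋆ₙₐ[ℂ] Λ.Toeplitz :=
  restrictAmbient
    { toFun x := ⟨fun i => x ⟨i.1.twist z, trivial⟩, memℓp_infty ⟨‖x‖, by
        rintro _ ⟨i, rfl⟩
        exact lp.norm_apply_le_norm ENNReal.top_ne_zero x ⟨i.1.twist z, trivial⟩⟩⟩
      map_smul' _ _ := rfl
      map_zero' := rfl
      map_add' _ _ := rfl
      map_mul' _ _ := rfl
      map_star' _ := rfl }
    fun μ => ((monomial z μ.deg : ℂ) • (t μ : Λ.Toeplitz)).2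

theorem gaugeHom_t (z : Fin k → Circle) (μ : Λ.Path) :
    gaugeHom z (t μ) = (monomial z μ.deg : ℂ) • t μ := rfl

theorem gaugeHom_mul (z w : Fin k → Circle) :
    (gaugeHom (Λ := Λ) z).comp (gaugeHom w) = gaugeHom (z * w) :=
  UnivAlg.hom_ext fun μ => by
    change gaugeHom z (gaugeHom w (t μ)) = gaugeHom (z * w) (t μ)
    rw [gaugeHom_t, map_smul, gaugeHom_t, gaugeHom_t, smul_smul, monomial_mul, Circle.coe_mul,
      mul_comm]

theorem gaugeHom_one : gaugeHom (Λ := Λ) 1 = .id ℂ _ :=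
  UnivAlg.hom_ext fun μ => by
    change gaugeHom 1 (t μ) = t μ
    simp [gaugeHom_t, monomial]

variable (Λ)

/-- The gauge action `γ` of `𝕋^k` on the Toeplitz algebra. -/
noncomputable def gauge : (Fin k → Circle) →* (Λ.Toeplitz ≃⋆ₐ[ℂ] Λ.Toeplitz) where
  toFun z := StarAlgEquiv.ofNonUnitalStarAlgHom (gaugeHom z) (gaugeHom z⁻¹)
    (by rw [gaugeHom_mul, inv_mul_cancel, gaugeHom_one])
    (by rw [gaugeHom_mul, mul_inv_cancel, gaugeHom_one])
  map_one' := by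
    refine StarAlgEquiv.ext fun x => ?_
    exact DFunLike.congr_fun (gaugeHom_one (Λ := Λ)) x
  map_mul' z w := by
    refine StarAlgEquiv.ext fun x => ?_
    exact DFunLike.congr_fun (gaugeHom_mul (Λ := Λ) z w).symm x

theorem gauge_t (z : Fin k → Circle) (μ : Λ.Path) :
    Λ.gauge z (t μ) = (monomial z μ.deg : ℂ) • t μ := rfl

/-- The dynamics `α_s = γ_{e^{isr}}` of `ℝ` on the Toeplitz algebra. -/
noncomputable def dynamics (r : Fin k → ℝ) (s : ℝ) : Λ.Toeplitz ≃⋆ₐ[ℂ] Λ.Toeplitz :=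
  Λ.gauge fun j => Circle.exp (s * r j)

end KGraph

/-! ### States and the KMS condition -/

/-- A state of a C⋆-algebra: a positive linear functional of norm `1`. -/
structure IsCStarState {A : Type*} [NonUnitalCStarAlgebra A] (φ : A →L[ℂ] ℂ) : Prop where
  nonneg : ∀ a, 0 ≤ φ (star a * a)
  norm_eq_one : ‖φ‖ = 1

/-- `F` is an entire extension of `s ↦ α_s(a)`.  The element `a` is analytic for `α` if there is
such an `F`; it is then unique, and `α_z(a) = F z`. -/
def IsEntireExtension {A : Type*} [NonUnitalCStarAlgebra A] (α : ℝ → A ≃⋆ₐ[ℂ] A) (a : A)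
    (F : ℂ → A) : Prop :=
  Differentiable ℂ F ∧ ∀ s : ℝ, F s = α s a

/-- The element `a` is analytic for `α`. -/
def IsAnalyticElement {A : Type*} [NonUnitalCStarAlgebra A] (α : ℝ → A ≃⋆ₐ[ℂ] A) (a : A) : Prop :=
  ∃ F : ℂ → A, IsEntireExtension α a F

open Classical in
/-- KMS states at inverse temperature `β`: for `β = 0` these are the invariant traces, and
otherwise the condition is `φ(ab) = φ(b α_{iβ}(a))` for all analytic elements `a` and `b`. -/
def IsKMSState {A : Type*} [NonUnitalCStarAlgebra A] (α : ℝ → A ≃⋆ₐ[ℂ] A) (β : ℝ)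
    (φ : A →L[ℂ] ℂ) : Prop :=
  IsCStarState φ ∧
    if β = 0 then (∀ s a, φ (α s a) = φ a) ∧ ∀ a b, φ (a * b) = φ (b * a)
    else ∀ a b F, IsEntireExtension α a F → IsAnalyticElement α b →
      φ (a * b) = φ (b * F (Complex.I * β))

/-!
For a Toeplitz-Cuntz-Krieger family `T` let `P_n = ∑ T_μ T_μ⋆`, where the sum is over all paths of
degree `n`.  The relations give `P_n T_μ = T_μ P_{(n ∨ d(μ)) - d(μ)}` (`IsTCKFamily.rangeProj_mul`)
and `∑_{d(μ) = m} T_μ P_n T_μ⋆ = P_{m + n}` (`IsTCKFamily.sum_mul_rangeProj_mul_star`).  So the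
`P_n` are commuting projections, and `P_{e_j}` commutes with `T_μ` if `d(μ)_j = 0`.  In the Toeplitz
algebra, `P_0 = ∑ q_v` is the unit, and a state has the value `1` there; this is `∑ m_v = 1`.

Products of generators are eigenvectors of the dynamics, and on eigenvectors the KMS condition reads
`φ(ab) = e^{-βθ} φ(ba)` if `α_s(a) = e^{isθ} a` (`IsKMSState.apply_mul`), for `β = 0` as well.  In
particular `φ(t_μ D t_μ⋆) = e^{-β r·d(μ)} φ(D q_{s(μ)})` for `D` fixed by the dynamics.  For the
projection `D_K = ∏_{i ∈ K} (1 - P_{e_i})` this gives, by induction on `K`, that `φ(q_v D_K)` is the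
entry at `v` of `∏_{i ∈ K} (1 - e^{-β r_i} A_i) m` (`exists_defect_projection`).  As `q_v D_K` is a
projection, the entry is nonnegative.

If `φ` factors through `C⋆(Λ)`, then it vanishes at `q_v (1 - P_{e_i})`, which says that
`A_i m = e^{β r_i} m`.  Conversely, these equations imply that `φ` vanishes at the projections
`q_v (1 - P_n)` for all `n` (`apply_vertex_mul_rangeProj`).  By the KMS condition the left kernel of
`φ` absorbs right multiplication (`kms_leftKernel_mul`), so these projections act as zero in the GNS
representation, and the images of the `t_μ` there form a Cuntz-Krieger family.  The vector state of
the resulting representation of `C⋆(Λ)` is the required factor of `φ`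
(`factors_of_apply_rangeProj`).  The graph algebra is universal for families in C⋆-algebras of the
universe of `Λ` only, and the Toeplitz algebra lives one universe higher; but its GNS spaces are
separable, so they are isometric to spaces `ℓ²(ι)` in the universe of `Λ`
(`IsCStarState.exists_gns`).
-/

/-! ### Factorisation of paths -/

namespace KGraph

variable {k : ℕ} {Λ : KGraph.{u} k}

theorem comp_vertex (μ : Λ.Path) : μ.comp (Path.vertex μ.source) rfl = μ := by
  simp [Path.comp, Path.vertex]

theorem Path.comp_congr {μ μ' ν ν' : Λ.Path} (hμ : μ = μ') (hν : ν = ν')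
    (h : μ.source = ν.range) : μ.comp ν h = μ'.comp ν' (hμ ▸ hν ▸ h) := by
  subst hμ hν; rfl

theorem exists_comp_eq (κ : Λ.Path) (m n : Fin k → ℕ) (h : κ.deg = m + n) :
    ∃ (μ ν : Λ.Path) (e : μ.source = ν.range), μ.deg = m ∧ ν.deg = n ∧ μ.comp ν e = κ := by
  obtain ⟨a, b, f⟩ := κ
  obtain ⟨⟨w, g, g'⟩, ⟨h₁, h₂, h₃⟩, -⟩ := Λ.factorisation f m n h
  refine ⟨⟨w, b, g'⟩, ⟨a, w, g⟩, rfl, h₁, h₂, ?_⟩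
  simpa [Path.comp] using h₃

theorem comp_right_cancel {μ ν η ζ : Λ.Path} (h₁ : μ.source = η.range) (h₂ : ν.source = ζ.range)
    (h : μ.comp η h₁ = ν.comp ζ h₂) (hd : μ.deg = ν.deg) : η = ζ := by
  have hdd := congrArg Path.deg h
  rw [Path.deg_comp, Path.deg_comp, hd, add_right_inj] at hdd
  obtain ⟨a, b, f⟩ := μ
  obtain ⟨a', b', f'⟩ := ν
  obtain ⟨c, d, g⟩ := η
  obtain ⟨c', d', g'⟩ := ζ
  obtain rfl : a = d := h₁
  obtain rfl : a' = d' := h₂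
  simp only [Path.comp, eqToHom_refl, Category.id_comp, Path.mk.injEq] at h
  obtain ⟨rfl, rfl, h⟩ := h
  have h' := eq_of_heq h
  have key := (Λ.factorisation (g ≫ f) _ _ (Λ.degree_comp g f)).unique
    (y₁ := ⟨a, g, f⟩) (y₂ := ⟨a', g', f'⟩) ⟨rfl, rfl, rfl⟩ ⟨hd.symm, hdd.symm, h'.symm⟩
  cases key
  rfl

theorem eq_vertex_of_deg_eq_zero {μ : Λ.Path} (h : μ.deg = 0) : μ = Path.vertex μ.range :=
  comp_left_cancel (μ := μ) (η := Path.vertex μ.source) (ν := Path.vertex μ.range) (ζ := μ) rfl rfl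
    ((comp_vertex μ).trans (vertex_comp μ).symm) (h.trans (deg_vertex _).symm)

instance countable_path [Λ.IsFinite] : Countable Λ.Path := by
  rw [← Set.countable_univ_iff]
  refine (Set.countable_iUnion fun n => (IsFinite.finite_deg (Λ := Λ) n).countable).mono ?_
  intro μ _
  exact Set.mem_iUnion.2 ⟨μ.deg, rfl⟩

variable [Λ.IsFinite]

variable (Λ) in
/-- The set `Λ^n` of all paths of degree `n`, as a finite set. -/
noncomputable def pathsOfDeg (n : Fin k → ℕ) : Finset Λ.Path :=
  (IsFinite.finite_deg (Λ := Λ) n).toFinset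

@[simp]
theorem mem_pathsOfDeg {n : Fin k → ℕ} {μ : Λ.Path} : μ ∈ Λ.pathsOfDeg n ↔ μ.deg = n := by
  simp [pathsOfDeg]

@[simp]
theorem mem_pathsTo {v : Λ.Vertex} {n : Fin k → ℕ} {μ : Λ.Path} :
    μ ∈ pathsTo v n ↔ μ.range = v ∧ μ.deg = n := by
  simp [pathsTo]

theorem pathsTo_eq_filter [DecidableEq Λ.Vertex] (v : Λ.Vertex) (n : Fin k → ℕ) :
    pathsTo v n = (Λ.pathsOfDeg n).filter (fun μ => μ.range = v) := by
  ext μ; simp [and_comm]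

theorem mem_minExt {μ ν : Λ.Path} {p : Λ.Path × Λ.Path} :
    p ∈ minExt μ ν ↔ ∃ (h₁ : μ.source = p.1.range) (h₂ : ν.source = p.2.range),
      μ.comp p.1 h₁ = ν.comp p.2 h₂ ∧ (μ.comp p.1 h₁).deg = μ.deg ⊔ ν.deg := by
  simp [minExt, minExtSet]

/-! ### Range projections of a Toeplitz-Cuntz-Krieger family -/

/-- The projection `P_n = ∑ T_μ T_μ⋆`, where the sum is over all paths `μ` of degree
`n`. -/
noncomputable def rangeProj {B : Type*} [NonUnitalCStarAlgebra B] (T : Λ.Path → B)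
    (n : Fin k → ℕ) : B :=
  ∑ μ ∈ Λ.pathsOfDeg n, T μ * star (T μ)

theorem star_rangeProj {B : Type*} [NonUnitalCStarAlgebra B] (T : Λ.Path → B) (n : Fin k → ℕ) :
    star (rangeProj T n) = rangeProj T n := by
  simp [rangeProj]

namespace IsTCKFamily

variable {B : Type*} [NonUnitalCStarAlgebra B] {T : Λ.Path → B} (hT : IsTCKFamily T)

include hT

theorem vertex_mul (μ : Λ.Path) : T (.vertex μ.range) * T μ = T μ := by
  rw [hT.map_comp _ _ rfl, vertex_comp]

theorem mul_vertex (μ : Λ.Path) : T μ * T (.vertex μ.source) = T μ := by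
  rw [hT.map_comp _ _ rfl, comp_vertex]

theorem vertex_mul_of_ne {v : Λ.Vertex} {μ : Λ.Path} (h : v ≠ μ.range) :
    T (.vertex v) * T μ = 0 := by
  rw [← hT.vertex_mul μ, ← mul_assoc, hT.orthogonal _ _ h, zero_mul]

theorem mul_of_ne {μ ν : Λ.Path} (h : μ.source ≠ ν.range) : T μ * T ν = 0 := by
  rw [← hT.mul_vertex μ, mul_assoc, hT.vertex_mul_of_ne h, mul_zero]

theorem star_vertex (v : Λ.Vertex) : star (T (.vertex v)) = T (.vertex v) :=
  (hT.projection v).isSelfAdjoint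

/-- The commutation relation `P_n T_μ = T_μ P_{(n ∨ d(μ)) - d(μ)}`: the minimal common extensions
`νη = μζ` with `d(ν) = n` correspond to the paths `ζ` of degree `(n ∨ d(μ)) - d(μ)` with
`r(ζ) = s(μ)`. -/
theorem rangeProj_mul (n : Fin k → ℕ) (μ : Λ.Path) :
    rangeProj T n * T μ = T μ * rangeProj T (n ⊔ μ.deg - μ.deg) := by
  have h1 : ∀ ν ∈ Λ.pathsOfDeg n, T ν * star (T ν) * T μ =
      ∑ p ∈ minExt ν μ, T μ * (T p.2 * star (T p.2)) := by
    intro ν _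
    rw [mul_assoc, hT.star_mul, Finset.mul_sum]
    refine Finset.sum_congr rfl fun p hp => ?_
    obtain ⟨h₁, h₂, h, -⟩ := mem_minExt.1 hp
    rw [← mul_assoc, ← mul_assoc, hT.map_comp _ _ h₁, hT.map_comp _ _ h₂, h]
  have hdeg : ∀ {ν : Λ.Path} {p : Λ.Path × Λ.Path}, ν.deg = n → p ∈ minExt ν μ →
      p.2.deg = n ⊔ μ.deg - μ.deg := by
    intro ν p hν hp
    obtain ⟨h₁, h₂, h, hd⟩ := mem_minExt.1 hp
    rw [h, Path.deg_comp, hν] at hd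
    rw [← hd, add_tsub_cancel_left]
  rw [rangeProj, Finset.sum_mul, Finset.sum_congr rfl h1, Finset.sum_sigma', rangeProj,
    Finset.mul_sum]
  refine Finset.sum_of_injOn (fun x => x.2.2) ?_ ?_ ?_ fun _ _ => rfl
  · rintro ⟨ν, η, ζ⟩ hx ⟨ν', η', ζ'⟩ hx' (rfl : ζ = ζ')
    simp only [Finset.coe_sigma, Set.mem_sigma_iff, Finset.mem_coe, mem_pathsOfDeg] at hx hx'
    obtain ⟨h₁, h₂, h, -⟩ := mem_minExt.1 hx.2
    obtain ⟨h₁', h₂', h', -⟩ := mem_minExt.1 hx'.2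
    have e := h.trans h'.symm
    have hd := hx.1.trans hx'.1.symm
    obtain rfl := comp_left_cancel _ _ e hd
    obtain rfl := comp_right_cancel _ _ e hd
    rfl
  · rintro ⟨ν, p⟩ hx
    simp only [Finset.coe_sigma, Set.mem_sigma_iff, Finset.mem_coe, mem_pathsOfDeg] at hx
    simpa using hdeg hx.1 hx.2
  · intro ζ hζ hx
    rw [mem_pathsOfDeg] at hζ
    by_cases hs : μ.source = ζ.range
    · refine absurd ?_ hx
      have hd : (μ.comp ζ hs).deg = n ⊔ μ.deg := by
        rw [Path.deg_comp, hζ, add_tsub_cancel_of_le le_sup_right]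
      obtain ⟨ν, η, e, hν, hη, h⟩ := exists_comp_eq (μ.comp ζ hs) n (n ⊔ μ.deg - n)
        (by rw [hd, add_tsub_cancel_of_le le_sup_left])
      refine ⟨⟨ν, η, ζ⟩, ?_, rfl⟩
      simp only [Finset.coe_sigma, Set.mem_sigma_iff, Finset.mem_coe, mem_pathsOfDeg]
      exact ⟨hν, mem_minExt.2 ⟨e, hs, h, by rw [h, hd, hν]⟩⟩
    · rw [← mul_assoc, hT.mul_of_ne hs, zero_mul]

theorem sum_mul_rangeProj_mul_star (m n : Fin k → ℕ) :
    ∑ μ ∈ Λ.pathsOfDeg m, T μ * rangeProj T n * star (T μ) = rangeProj T (m + n) := by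
  have h1 : ∀ μ ∈ Λ.pathsOfDeg m, T μ * rangeProj T n * star (T μ) =
      ∑ ν ∈ Λ.pathsOfDeg n, T μ * T ν * star (T μ * T ν) := by
    intro μ _
    rw [rangeProj, Finset.mul_sum, Finset.sum_mul]
    exact Finset.sum_congr rfl fun ν _ => by rw [StarMul.star_mul]; simp only [mul_assoc]
  rw [Finset.sum_congr rfl h1, Finset.sum_sigma', rangeProj, eq_comm]
  -- Every path of degree `m + n` is split into its parts of degrees `m` and `n`.
  have : ∀ κ : Λ.Path, ∃ p : (_ : Λ.Path) × Λ.Path, κ.deg = m + n →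
      ∃ e : p.1.source = p.2.range, p.1.deg = m ∧ p.2.deg = n ∧ p.1.comp p.2 e = κ := by
    intro κ
    by_cases h : κ.deg = m + n
    · obtain ⟨μ, ν, e, h⟩ := exists_comp_eq κ m n h
      exact ⟨⟨μ, ν⟩, fun _ => ⟨e, h⟩⟩
    · exact ⟨⟨κ, κ⟩, fun h' => absurd h' h⟩
  choose F hF using this
  refine Finset.sum_of_injOn F ?_ ?_ ?_ ?_
  · intro κ hκ κ' hκ' h
    simp only [Finset.mem_coe, mem_pathsOfDeg] at hκ hκ'
    obtain ⟨e, -, -, h₁⟩ := hF κ hκ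
    obtain ⟨e', -, -, h₂⟩ := hF κ' hκ'
    rw [← h₁, ← h₂]
    exact Path.comp_congr (by rw [h]) (by rw [h]) _
  · intro κ hκ
    simp only [Finset.mem_coe, mem_pathsOfDeg] at hκ
    obtain ⟨e, h₁, h₂, -⟩ := hF κ hκ
    simp [h₁, h₂]
  · rintro ⟨μ, ν⟩ hp hx
    simp only [Finset.mem_sigma, mem_pathsOfDeg] at hp
    by_cases hs : μ.source = ν.range
    · refine absurd ?_ hx
      have hd : (μ.comp ν hs).deg = m + n := by rw [Path.deg_comp, hp.1, hp.2]
      refine ⟨μ.comp ν hs, by simpa using hd, ?_⟩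
      obtain ⟨e, h₁, h₂, h₃⟩ := hF _ hd
      have hd' := h₁.trans hp.1.symm
      exact Sigma.ext (comp_left_cancel _ _ h₃ hd') (heq_of_eq (comp_right_cancel _ _ h₃ hd'))
    · simp [hT.mul_of_ne hs]
  · intro κ hκ
    simp only [mem_pathsOfDeg] at hκ
    obtain ⟨e, -, -, h₁⟩ := hF κ hκ
    rw [hT.map_comp _ _ e, h₁]

theorem rangeProj_mul_rangeProj (m n : Fin k → ℕ) :
    rangeProj T m * rangeProj T n = rangeProj T (m ⊔ n) := by
  rw [rangeProj.eq_def T n, Finset.mul_sum]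
  calc _ = ∑ μ ∈ Λ.pathsOfDeg n, T μ * rangeProj T (m ⊔ n - n) * star (T μ) :=
        Finset.sum_congr rfl fun μ hμ => by
          rw [← mul_assoc, hT.rangeProj_mul, mem_pathsOfDeg.1 hμ]
    _ = _ := by rw [hT.sum_mul_rangeProj_mul_star, add_tsub_cancel_of_le le_sup_right]

theorem vertex_mul_rangeProj_comm (v : Λ.Vertex) (n : Fin k → ℕ) :
    T (.vertex v) * rangeProj T n = rangeProj T n * T (.vertex v) := by
  simp [hT.rangeProj_mul, deg_vertex]

theorem vertex_mul_sum_mul_star (a : B) (v : Λ.Vertex) (n : Fin k → ℕ) :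
    T (.vertex v) * ∑ μ ∈ Λ.pathsOfDeg n, T μ * a * star (T μ) =
      ∑ μ ∈ pathsTo v n, T μ * a * star (T μ) := by
  classical
  rw [pathsTo_eq_filter, Finset.sum_filter, Finset.mul_sum]
  refine Finset.sum_congr rfl fun μ _ => ?_
  split_ifs with h
  · rw [← h, ← mul_assoc, ← mul_assoc, hT.vertex_mul]
  · rw [← mul_assoc, ← mul_assoc, hT.vertex_mul_of_ne (Ne.symm h), zero_mul, zero_mul]

theorem vertex_mul_rangeProj (v : Λ.Vertex) (n : Fin k → ℕ) :
    T (.vertex v) * rangeProj T n = ∑ μ ∈ pathsTo v n, T μ * star (T μ) := by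
  classical
  rw [pathsTo_eq_filter, Finset.sum_filter, rangeProj, Finset.mul_sum]
  refine Finset.sum_congr rfl fun μ _ => ?_
  split_ifs with h
  · rw [← h, ← mul_assoc, hT.vertex_mul]
  · rw [← mul_assoc, hT.vertex_mul_of_ne (Ne.symm h), zero_mul]

theorem vertex_mul_rangeProj_zero (v : Λ.Vertex) :
    T (.vertex v) * rangeProj T 0 = T (.vertex v) := by
  have : pathsTo v (0 : Fin k → ℕ) = {Path.vertex v} := by
    ext μ
    simp only [mem_pathsTo, Finset.mem_singleton]
    constructor
    · rintro ⟨rfl, h⟩; exact eq_vertex_of_deg_eq_zero h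
    · rintro rfl; exact ⟨rfl, deg_vertex v⟩
  rw [hT.vertex_mul_rangeProj, this, Finset.sum_singleton, hT.star_vertex,
    (hT.projection v).isIdempotentElem]

theorem rangeProj_zero_mul (μ : Λ.Path) : rangeProj T 0 * T μ = T μ := by
  have h : T (.vertex μ.range) * (rangeProj T 0 * T μ) = T μ := by
    rw [← mul_assoc, hT.vertex_mul_rangeProj_zero, hT.vertex_mul]
  have h0 : (0 : Fin k → ℕ) ⊔ μ.deg - μ.deg = 0 := by simp
  rwa [hT.rangeProj_mul, h0, ← mul_assoc, hT.vertex_mul, ← h0, ← hT.rangeProj_mul] at h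

theorem mul_rangeProj_zero (μ : Λ.Path) : T μ * rangeProj T 0 = T μ := by
  rw [← hT.mul_vertex, mul_assoc, hT.vertex_mul_rangeProj_zero]

theorem rangeProj_zero [Fintype Λ.Vertex] : rangeProj T 0 = ∑ v, T (.vertex v) := by
  classical
  have h1 : (∑ v, T (.vertex v)) * rangeProj T 0 = rangeProj T 0 := by
    rw [rangeProj, Finset.mul_sum]
    refine Finset.sum_congr rfl fun μ _ => ?_
    rw [← mul_assoc, Finset.sum_mul, Finset.sum_eq_single μ.range, hT.vertex_mul]
    · intro v _ h; exact hT.vertex_mul_of_ne h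
    · simp
  rw [← h1, Finset.sum_mul]
  exact Finset.sum_congr rfl fun v _ => hT.vertex_mul_rangeProj_zero v

/-- The span of the elements `T_μ T_ν⋆` is closed under multiplication. -/
theorem mul_star_mul_mem_span (μ ν κ τ : Λ.Path) :
    T μ * star (T ν) * (T κ * star (T τ)) ∈
      Submodule.span ℂ (Set.range fun p : Λ.Path × Λ.Path => T p.1 * star (T p.2)) := by
  have h : T μ * star (T ν) * (T κ * star (T τ)) =
      ∑ p ∈ minExt ν κ, T μ * T p.1 * star (T τ * T p.2) := by
    calc _ = T μ * (star (T ν) * T κ) * star (T τ) := by simp only [mul_assoc]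
      _ = _ := by
        rw [hT.star_mul, Finset.mul_sum, Finset.sum_mul]
        exact Finset.sum_congr rfl fun p _ => by rw [StarMul.star_mul]; simp only [mul_assoc]
  rw [h]
  refine Submodule.sum_mem _ fun p _ => ?_
  by_cases h₁ : μ.source = p.1.range
  · by_cases h₂ : τ.source = p.2.range
    · rw [hT.map_comp _ _ h₁, hT.map_comp _ _ h₂]
      exact Submodule.subset_span ⟨(_, _), rfl⟩
    · rw [hT.mul_of_ne h₂, star_zero, mul_zero]; exact zero_mem _
  · rw [hT.mul_of_ne h₁, zero_mul]; exact zero_mem _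

end IsTCKFamily

end KGraph

namespace KGraph

variable {k : ℕ} {Λ : KGraph.{u} k} [Λ.IsFinite]

/-! ### The span of the elements `t_μ t_ν⋆` -/

/-- A closed property of elements of the universal algebra that holds for the generators and is
preserved by the algebraic operations holds everywhere. -/
theorem UnivAlg.induction {S : Set Λ.TCKRep} {p : UnivAlg S → Prop}
    (closed : IsClosed {x | p x}) (gen : ∀ μ, p (univGen S μ)) (zero : p 0)
    (add : ∀ x y, p x → p y → p (x + y)) (mul : ∀ x y, p x → p y → p (x * y))
    (smul : ∀ (c : ℂ) x, p x → p (c • x)) (star : ∀ x, p x → p (star x)) (x : UnivAlg S) :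
    p x := by
  have key : ∀ x (hx : x ∈ NonUnitalStarAlgebra.adjoin ℂ (Set.range (ambientGen S))),
      p ⟨x, NonUnitalStarSubalgebra.le_topologicalClosure _ hx⟩ := by
    intro x hx
    induction hx using NonUnitalStarAlgebra.adjoin_induction with
    | mem x hx => obtain ⟨μ, rfl⟩ := hx; exact gen μ
    | add x y hx hy ihx ihy => exact add _ _ ihx ihy
    | zero => exact zero
    | mul x y hx hy ihx ihy => exact mul _ _ ihx ihy
    | smul c x hx ih => exact smul _ _ ih
    | star x hx ih => exact star _ ih
  obtain ⟨x, hx⟩ := x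
  have hx' : x ∈ closure
      (NonUnitalStarAlgebra.adjoin ℂ (Set.range (ambientGen S)) : Set (Ambient S)) := hx
  have hmem : (⟨x, hx⟩ : UnivAlg S) ∈ closure
      {y : UnivAlg S | y.1 ∈ NonUnitalStarAlgebra.adjoin ℂ (Set.range (ambientGen S))} := by
    rw [closure_subtype]
    convert hx' using 2
    ext y
    constructor
    · rintro ⟨z, hz, rfl⟩; exact hz
    · intro hy
      exact ⟨⟨y, NonUnitalStarSubalgebra.le_topologicalClosure _ hy⟩, hy, rfl⟩
  exact closure_minimal (fun y hy => key y.1 hy) closed hmem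

theorem isTCKFamily_t : IsTCKFamily (t : Λ.Path → Λ.Toeplitz) := isTCKFamily_univGen _

variable (Λ) in
/-- The linear span of the spanning family `t_μ t_ν⋆` of the Toeplitz algebra. -/
noncomputable def spanMulStar : Submodule ℂ Λ.Toeplitz :=
  Submodule.span ℂ (Set.range fun p : Λ.Path × Λ.Path => t p.1 * star (t p.2))

theorem mul_mem_spanMulStar {x y : Λ.Toeplitz} (hx : x ∈ Λ.spanMulStar) (hy : y ∈ Λ.spanMulStar) :
    x * y ∈ Λ.spanMulStar := by
  induction hx using Submodule.span_induction with
  | mem x hx =>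
    obtain ⟨p, rfl⟩ := hx
    induction hy using Submodule.span_induction with
    | mem y hy =>
      obtain ⟨p', rfl⟩ := hy
      exact isTCKFamily_t.mul_star_mul_mem_span _ _ _ _
    | zero => rw [mul_zero]; exact zero_mem _
    | add a b _ _ ha hb => rw [mul_add]; exact add_mem ha hb
    | smul c a _ ha => rw [mul_smul_comm]; exact Submodule.smul_mem _ _ ha
  | zero => rw [zero_mul]; exact zero_mem _
  | add a b _ _ ha hb => rw [add_mul]; exact add_mem ha hb
  | smul c a _ ha => rw [smul_mul_assoc]; exact Submodule.smul_mem _ _ ha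

theorem star_mem_spanMulStar {x : Λ.Toeplitz} (hx : x ∈ Λ.spanMulStar) :
    star x ∈ Λ.spanMulStar := by
  induction hx using Submodule.span_induction with
  | mem x hx =>
    obtain ⟨p, rfl⟩ := hx
    rw [StarMul.star_mul, star_star]
    exact Submodule.subset_span ⟨(p.2, p.1), rfl⟩
  | zero => rw [star_zero]; exact zero_mem _
  | add a b _ _ ha hb => rw [star_add]; exact add_mem ha hb
  | smul c a _ ha => rw [star_smul]; exact Submodule.smul_mem _ _ ha

theorem mem_closure_spanMulStar (x : Λ.Toeplitz) :
    x ∈ closure (Λ.spanMulStar : Set Λ.Toeplitz) := by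
  refine UnivAlg.induction (p := fun x => x ∈ closure (Λ.spanMulStar : Set Λ.Toeplitz))
    isClosed_closure ?_ ?_ ?_ ?_ ?_ ?_ x
  · intro μ
    refine subset_closure (Submodule.subset_span ⟨(μ, .vertex μ.source), ?_⟩)
    change t μ * star (t (.vertex μ.source)) = t μ
    rw [isTCKFamily_t.star_vertex, isTCKFamily_t.mul_vertex]
  · exact subset_closure (zero_mem _)
  · exact fun x y hx hy => map_mem_closure₂ continuous_add hx hy fun _ ha _ hb => add_mem ha hb
  · exact fun x y hx hy =>
      map_mem_closure₂ continuous_mul hx hy fun _ ha _ hb => mul_mem_spanMulStar ha hb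
  · exact fun c x hx => map_mem_closure (continuous_const_smul c) hx fun _ ha =>
      Submodule.smul_mem _ _ ha
  · exact fun x hx => map_mem_closure continuous_star hx fun _ ha => star_mem_spanMulStar ha

instance separableSpace_toeplitz : TopologicalSpace.SeparableSpace Λ.Toeplitz := by
  rw [← TopologicalSpace.isSeparable_univ_iff]
  refine (((Set.countable_range fun p : Λ.Path × Λ.Path =>
    (t p.1 * star (t p.2) : Λ.Toeplitz)).isSeparable.span (R := ℂ)).closure).mono ?_
  exact fun x _ => mem_closure_spanMulStar x

/-- `rangeProj t 0 = ∑ q_v` is the unit of the Toeplitz algebra. -/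
theorem rangeProj_zero_mul (x : Λ.Toeplitz) : rangeProj t 0 * x = x := by
  refine UnivAlg.induction (p := fun x : Λ.Toeplitz => rangeProj t 0 * x = x ∧
      x * rangeProj t 0 = x)
    ((isClosed_eq (by fun_prop) (by fun_prop)).inter (isClosed_eq (by fun_prop) (by fun_prop)))
    (fun μ => ⟨isTCKFamily_t.rangeProj_zero_mul μ, isTCKFamily_t.mul_rangeProj_zero μ⟩)
    (by simp) ?_ ?_ ?_ ?_ x |>.1
  · rintro x y ⟨h₁, h₂⟩ ⟨h₃, h₄⟩; simp [mul_add, add_mul, *]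
  · rintro x y ⟨h₁, h₂⟩ ⟨h₃, h₄⟩
    exact ⟨by rw [← mul_assoc, h₁], by rw [mul_assoc, h₄]⟩
  · rintro c x ⟨h₁, h₂⟩
    exact ⟨by rw [mul_smul_comm, h₁], by rw [smul_mul_assoc, h₂]⟩
  · rintro x ⟨h₁, h₂⟩
    rw [← star_inj, StarMul.star_mul, star_rangeProj] at h₁ h₂
    exact ⟨h₂, h₁⟩

theorem mul_rangeProj_zero (x : Λ.Toeplitz) : x * rangeProj t 0 = x := by
  rw [← star_inj, StarMul.star_mul, star_rangeProj, rangeProj_zero_mul]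

theorem norm_rangeProj_zero_le : ‖(rangeProj t 0 : Λ.Toeplitz)‖ ≤ 1 :=
  IsStarProjection.norm_le _ ⟨rangeProj_zero_mul _, star_rangeProj _ _⟩

/-! ### Elements that are homogeneous for the dynamics -/

/-- `a` is an eigenvector of the dynamics: `α_s(a) = e^{isθ} a` for all `s`. -/
def IsHomogeneous (r : Fin k → ℝ) (θ : ℝ) (a : Λ.Toeplitz) : Prop :=
  ∀ s : ℝ, Λ.dynamics r s a = Complex.exp (Complex.I * s * θ) • a

namespace IsHomogeneous

variable {r : Fin k → ℝ} {θ θ' : ℝ} {a b : Λ.Toeplitz}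

theorem mul (ha : IsHomogeneous r θ a) (hb : IsHomogeneous r θ' b) :
    IsHomogeneous r (θ + θ') (a * b) := fun s => by
  rw [map_mul, ha, hb, smul_mul_smul_comm, ← Complex.exp_add]
  push_cast; ring_nf

theorem star (ha : IsHomogeneous r θ a) : IsHomogeneous r (-θ) (star a) := fun s => by
  rw [map_star, ha, star_smul, Complex.star_def, ← Complex.exp_conj]
  simp

theorem sub (ha : IsHomogeneous r θ a) (hb : IsHomogeneous r θ b) :
    IsHomogeneous r θ (a - b) := fun s => by
  rw [map_sub, ha, hb, smul_sub]

theorem sum {ι : Type*} {s : Finset ι} {f : ι → Λ.Toeplitz}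
    (h : ∀ i ∈ s, IsHomogeneous r θ (f i)) : IsHomogeneous r θ (∑ i ∈ s, f i) := fun x => by
  rw [map_sum, Finset.smul_sum]
  exact Finset.sum_congr rfl fun i hi => h i hi x

theorem t (r : Fin k → ℝ) (μ : Λ.Path) :
    IsHomogeneous r (∑ j, r j * μ.deg j) (KGraph.t μ) := fun s => by
  change (monomial _ μ.deg : ℂ) • KGraph.t μ = _
  congr 1
  have h (j : Fin k) : Circle.coeHom (Circle.exp (s * r j) ^ μ.deg j) =
      Complex.exp (Complex.I * s * (r j * μ.deg j)) := by
    refine (map_pow Circle.coeHom _ _).trans ?_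
    change (Circle.exp (s * r j) : ℂ) ^ μ.deg j = _
    rw [Circle.coe_exp, ← Complex.exp_nat_mul]
    congr 1
    push_cast
    ring
  refine (map_prod Circle.coeHom _ _).trans ?_
  rw [Finset.prod_congr rfl fun j _ => h j, ← Complex.exp_sum, ← Finset.mul_sum]
  push_cast
  rfl

theorem q (r : Fin k → ℝ) (v : Λ.Vertex) : IsHomogeneous r 0 (KGraph.t (.vertex v)) := by
  simpa [deg_vertex] using t r (.vertex v)

theorem rangeProj (r : Fin k → ℝ) (n : Fin k → ℕ) :
    IsHomogeneous r 0 (KGraph.rangeProj (KGraph.t (Λ := Λ)) n) :=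
  .sum fun μ _ => by simpa using (t r μ).mul (t r μ).star

theorem isEntireExtension (ha : IsHomogeneous r θ a) :
    IsEntireExtension (Λ.dynamics r) a fun z => Complex.exp (Complex.I * z * θ) • a :=
  ⟨by fun_prop, fun s => (ha s).symm⟩

end IsHomogeneous

/-- The KMS condition `φ(ab) = e^{-βθ} φ(ba)` for homogeneous elements;
for `β = 0` it is the trace property. -/
theorem _root_.IsKMSState.apply_mul {r : Fin k → ℝ} {β : ℝ} {φ : Λ.Toeplitz →L[ℂ] ℂ}
    (hφ : IsKMSState (Λ.dynamics r) β φ) {θ θ' : ℝ} {a b : Λ.Toeplitz}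
    (ha : IsHomogeneous r θ a) (hb : IsHomogeneous r θ' b) :
    φ (a * b) = Real.exp (-(β * θ)) * φ (b * a) := by
  obtain ⟨-, h⟩ := hφ
  split_ifs at h with h0
  · simpa [h0] using h.2 a b
  · rw [h a b _ ha.isEntireExtension ⟨_, hb.isEntireExtension⟩, mul_smul_comm, map_smul,
      smul_eq_mul]
    congr 1
    push_cast
    congr 1
    linear_combination (β * θ : ℂ) * Complex.I_sq

end KGraph

/-! ### Positive functionals -/

namespace IsCStarState

variable {A : Type*} [NonUnitalCStarAlgebra A] {φ : A →L[ℂ] ℂ} (hφ : IsCStarState φ)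

include hφ

/-- A state, as a positive linear map for the order of the C⋆-algebra. -/
noncomputable def toPositiveLinearMap [PartialOrder A] [StarOrderedRing A] : A →ₚ[ℂ] ℂ :=
  .mk₀ φ.toLinearMap fun x hx => by
    obtain ⟨y, rfl⟩ := CStarAlgebra.nonneg_iff_eq_star_mul_self.1 hx
    exact hφ.nonneg y

/-- The Cauchy-Schwarz inequality for the semi-inner product `φ(x⋆ y)`. -/
theorem cauchy_schwarz (x y : A) :
    ‖φ (star x * y)‖ ^ 2 ≤ ‖φ (star x * x)‖ * ‖φ (star y * y)‖ := by
  let _ := CStarAlgebra.spectralOrder A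
  have := CStarAlgebra.spectralOrderedRing A
  let f := hφ.toPositiveLinearMap
  have h := norm_inner_le_norm (𝕜 := ℂ) (f.toPreGNS x) (f.toPreGNS y)
  have h2 : ∀ a, ‖f.toPreGNS a‖ ^ 2 = ‖φ (star a * a)‖ := fun a => by
    have := congrArg norm (f.preGNS_norm_sq (f.toPreGNS a))
    have h3 : ‖f.toPreGNS a‖ ^ 2 = ‖f (star a * a)‖ := by simpa using this
    exact h3
  rw [← h2, ← h2, ← mul_pow]
  exact pow_le_pow_left₀ (norm_nonneg _) h 2

theorem apply_star_mul_eq_zero {x : A} (hx : φ (star x * x) = 0) (y : A) :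
    φ (star x * y) = 0 := by
  have := hφ.cauchy_schwarz x y
  rw [hx, norm_zero, zero_mul] at this
  simpa using this

end IsCStarState

namespace KGraph

variable {k : ℕ} {Λ : KGraph.{u} k} [Λ.IsFinite]

/-- A state takes the value `1` at the unit of the Toeplitz algebra: Cauchy-Schwarz gives
`‖φ‖ ≤ √φ(1)`, and `‖φ‖ = 1`. -/
theorem _root_.IsCStarState.apply_rangeProj_zero {φ : Λ.Toeplitz →L[ℂ] ℂ} (hφ : IsCStarState φ) :
    φ (rangeProj t 0) = 1 := by
  set P : Λ.Toeplitz := rangeProj t 0 with hP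
  have hPs : star P = P := star_rangeProj _ _
  have hPP : P * P = P := rangeProj_zero_mul P
  have h1 : ‖φ P‖ ≤ 1 := by
    refine (φ.le_opNorm P).trans ?_
    rw [hφ.norm_eq_one, one_mul]
    exact norm_rangeProj_zero_le
  have h2 : ∀ a, ‖φ a‖ ^ 2 ≤ ‖φ P‖ * ‖a‖ ^ 2 := fun a => by
    have h := hφ.cauchy_schwarz P a
    rw [hPs, hPP, rangeProj_zero_mul] at h
    refine h.trans (mul_le_mul_of_nonneg_left ?_ (norm_nonneg _))
    refine (φ.le_opNorm _).trans ?_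
    rw [hφ.norm_eq_one, one_mul, CStarRing.norm_star_mul_self, sq]
  have h3 : ‖φ‖ ≤ √‖φ P‖ := φ.opNorm_le_bound (Real.sqrt_nonneg _) fun a => by
    refine abs_le_of_sq_le_sq' ?_ (by positivity) |>.2
    rw [mul_pow, Real.sq_sqrt (norm_nonneg _)]
    exact h2 a
  rw [hφ.norm_eq_one, Real.one_le_sqrt] at h3
  have h4 : 0 ≤ φ P := by have := hφ.nonneg P; rwa [hPs, hPP] at this
  have h5 : φ P = (‖φ P‖ : ℂ) := (RCLike.norm_of_nonneg' h4).symm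
  rw [h5, le_antisymm h1 h3, Complex.ofReal_one]

end KGraph

/-! ### Subinvariance of the vertex measure -/

namespace KGraph

variable {k : ℕ} {Λ : KGraph.{u} k} [Λ.IsFinite]

theorem card_filter_pathsTo [DecidableEq Λ.Vertex] (v w : Λ.Vertex) (n : Fin k → ℕ) :
    ((pathsTo v n).filter fun μ => μ.source = w).card =
      Nat.card {f : w ⟶ v // Λ.degree f = n} := by
  rw [← Nat.card_eq_finsetCard]
  refine (Nat.card_congr (Equiv.ofBijective
    (fun f => ⟨⟨w, v, f.1⟩, by simpa [Path.deg] using f.2⟩) ⟨?_, ?_⟩)).symm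
  · intro f g h
    simpa [Subtype.ext_iff] using h
  · rintro ⟨⟨a, b, f⟩, h⟩
    simp only [Finset.mem_filter, mem_pathsTo] at h
    obtain ⟨⟨rfl, hd⟩, rfl⟩ := h
    exact ⟨⟨f, hd⟩, rfl⟩

theorem sum_pathsTo_source [Fintype Λ.Vertex] [DecidableEq Λ.Vertex] (i : Fin k)
    (x : Λ.Vertex → ℝ) (v : Λ.Vertex) :
    ∑ μ ∈ pathsTo v (Pi.single i 1), x μ.source = (Λ.vertexMatrix i).mulVec x v := by
  rw [← Finset.sum_fiberwise (pathsTo v (Pi.single i 1)) (fun μ => μ.source), Matrix.mulVec,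
    dotProduct]
  refine Finset.sum_congr rfl fun w _ => ?_
  rw [Finset.sum_congr rfl fun μ hμ => by rw [(Finset.mem_filter.1 hμ).2], Finset.sum_const,
    card_filter_pathsTo, nsmul_eq_mul]
  rfl

theorem subinvarianceProd_empty [Fintype Λ.Vertex] [DecidableEq Λ.Vertex] (r : Fin k → ℝ) (β : ℝ) :
    Λ.subinvarianceProd r β ∅ = 1 :=
  Finset.noncommProd_empty _ _

theorem subinvarianceProd_insert [Fintype Λ.Vertex] [DecidableEq Λ.Vertex] (r : Fin k → ℝ) (β : ℝ)
    {i : Fin k} {K : Finset (Fin k)} (hi : i ∉ K) :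
    Λ.subinvarianceProd r β (insert i K) =
      (1 - Real.exp (-(β * r i)) • Λ.vertexMatrix i) * Λ.subinvarianceProd r β K :=
  Finset.noncommProd_insert_of_notMem _ _ _ _ hi

section KMS

variable {r : Fin k → ℝ} {β : ℝ} {φ : Λ.Toeplitz →L[ℂ] ℂ} (hφ : IsKMSState (Λ.dynamics r) β φ)

include hφ

theorem kms_apply_conj {D : Λ.Toeplitz} (hD : IsHomogeneous r 0 D) (μ : Λ.Path) :
    φ (t μ * D * star (t μ)) =
      Real.exp (-(β * ∑ j, r j * μ.deg j)) * φ (D * t (.vertex μ.source)) := by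
  rw [mul_assoc, hφ.apply_mul (.t r μ) (hD.mul (IsHomogeneous.t r μ).star), mul_assoc,
    isTCKFamily_t.star_mul_self]

theorem kms_apply_vertex (v : Λ.Vertex) : φ (t (.vertex v)) = ((φ (t (.vertex v))).re : ℂ) := by
  have h := hφ.1.nonneg (t (.vertex v))
  rw [isTCKFamily_t.star_mul_self] at h
  exact Complex.ext rfl (Complex.nonneg_iff.1 h).2.symm

/-- The projection is the product of the commuting projections `1 - P_{e_i}` over `i ∈ K`, where
`P_n = ∑ t_μ t_μ⋆` over the paths of degree `n`. -/
theorem exists_defect_projection [Fintype Λ.Vertex] [DecidableEq Λ.Vertex] (K : Finset (Fin k)) :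
    ∃ D : Λ.Toeplitz, star D = D ∧ D * D = D ∧ IsHomogeneous r 0 D ∧
      (∀ n, D * rangeProj t n = rangeProj t n * D) ∧
      (∀ μ : Λ.Path, (∀ j ∈ K, μ.deg j = 0) → D * t μ = t μ * D) ∧
      ∀ v, φ (t (.vertex v) * D) =
        ((Λ.subinvarianceProd r β K).mulVec (fun w => (φ (t (.vertex w))).re) v : ℝ) := by
  have hT := isTCKFamily_t (Λ := Λ)
  induction K using Finset.induction_on with
  | empty =>
    refine ⟨rangeProj t 0, star_rangeProj _ _, rangeProj_zero_mul _, .rangeProj r 0, ?_, ?_, ?_⟩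
    · intro n
      rw [hT.rangeProj_mul_rangeProj, hT.rangeProj_mul_rangeProj, sup_comm]
    · intro μ _
      rw [hT.rangeProj_zero_mul, hT.mul_rangeProj_zero]
    · intro v
      rw [hT.vertex_mul_rangeProj_zero, kms_apply_vertex hφ]
      rw [subinvarianceProd_empty, Matrix.one_mulVec]
  | insert i K hi ih =>
    obtain ⟨D, hDs, hDD, hD0, hDP, hDt, hDm⟩ := ih
    set P : Λ.Toeplitz := rangeProj t (Pi.single i 1) with hP
    have hPs : star P = P := star_rangeProj _ _
    have hPP : P * P = P := by rw [hP, hT.rangeProj_mul_rangeProj, sup_idem]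
    have hPt : ∀ μ : Λ.Path, μ.deg i = 0 → P * t μ = t μ * P := fun μ hμ => by
      have h : (Pi.single i 1 : Fin k → ℕ) ⊔ μ.deg - μ.deg = Pi.single i 1 := by
        ext j
        by_cases hj : j = i
        · subst hj; simp [hμ]
        · simp [hj]
      rw [hP, hT.rangeProj_mul, h]
    have hDPc : D * P = P * D := hDP _
    refine ⟨D - D * P, ?_, ?_, hD0.sub (by simpa using hD0.mul (.rangeProj r _)), ?_, ?_, ?_⟩
    · rw [star_sub, StarMul.star_mul, hDs, hPs, hDPc]
    · have h1 : D * P * D = D * P := by rw [hDPc, mul_assoc, hDD]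
      have h2 : D * (D * P) = D * P := by rw [← mul_assoc, hDD]
      have h3 : D * P * (D * P) = D * P := by rw [← mul_assoc, h1, mul_assoc, hPP]
      rw [sub_mul, mul_sub, mul_sub, hDD, h1, h2, h3, sub_self, sub_zero]
    · intro n
      have h1 : P * rangeProj t n = rangeProj t n * P := by
        rw [hP, hT.rangeProj_mul_rangeProj, hT.rangeProj_mul_rangeProj, sup_comm]
      rw [sub_mul, mul_sub, hDP, mul_assoc, h1, ← mul_assoc, hDP, mul_assoc]
    · intro μ hμ
      rw [sub_mul, mul_sub, hDt μ fun j hj => hμ j (Finset.mem_insert_of_mem hj), mul_assoc,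
        hPt μ (hμ i (Finset.mem_insert_self _ _)), ← mul_assoc,
        hDt μ fun j hj => hμ j (Finset.mem_insert_of_mem hj), mul_assoc]
    · intro v
      have hDv : ∀ v : Λ.Vertex, D * t (.vertex v) = t (.vertex v) * D := fun v =>
        hDt _ fun j _ => by simp [deg_vertex]
      have h1 : t (.vertex v) * (D * P) =
          ∑ μ ∈ pathsTo v (Pi.single i 1), t μ * D * star (t μ) := by
        rw [← mul_assoc, ← hDv, mul_assoc, hP, hT.vertex_mul_rangeProj, Finset.mul_sum]
        refine Finset.sum_congr rfl fun μ hμ => ?_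
        rw [← mul_assoc, hDt μ fun j hj => ?_]
        rw [(mem_pathsTo.1 hμ).2, Pi.single_eq_of_ne]
        rintro rfl
        exact hi hj
      have h2 : ∀ μ ∈ pathsTo v (Pi.single i 1), φ (t μ * D * star (t μ)) =
          ((Real.exp (-(β * r i)) * (Λ.subinvarianceProd r β K).mulVec
            (fun w => (φ (t (.vertex w))).re) μ.source : ℝ) : ℂ) := fun μ hμ => by
        rw [kms_apply_conj hφ hD0, hDv, hDm, (mem_pathsTo.1 hμ).2, Complex.ofReal_mul]
        congr 5
        rw [Finset.sum_eq_single i] <;> simp +contextual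
      rw [mul_sub, map_sub, h1, map_sum, Finset.sum_congr rfl h2, ← Complex.ofReal_sum,
        ← Finset.mul_sum, sum_pathsTo_source, hDm, subinvarianceProd_insert r β hi,
        ← Matrix.mulVec_mulVec, Matrix.sub_mulVec, Matrix.one_mulVec, Matrix.smul_mulVec]
      simp

theorem subinvariance [Fintype Λ.Vertex] [DecidableEq Λ.Vertex] (K : Finset (Fin k)) :
    0 ≤ (Λ.subinvarianceProd r β K).mulVec fun w => (φ (t (.vertex w))).re := fun v => by
  obtain ⟨D, hDs, hDD, -, -, hDt, hDm⟩ := exists_defect_projection hφ K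
  have hT := isTCKFamily_t (Λ := Λ)
  have hc : D * t (.vertex v) = t (.vertex v) * D := hDt _ fun j _ => by simp [deg_vertex]
  have h : star (t (.vertex v) * D) * (t (.vertex v) * D) = t (.vertex v) * D := by
    rw [StarMul.star_mul, hDs, hT.star_vertex, hc, mul_assoc, ← mul_assoc D, hc, mul_assoc, hDD,
      ← mul_assoc, (hT.projection v).isIdempotentElem]
  have := hφ.1.nonneg (t (.vertex v) * D)
  rw [h, hDm] at this
  exact_mod_cast this

theorem sum_apply_vertex [Fintype Λ.Vertex] : ∑ v, (φ (t (.vertex v))).re = 1 := by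
  have h := hφ.1.apply_rangeProj_zero
  rw [isTCKFamily_t.rangeProj_zero, map_sum] at h
  simpa using congrArg Complex.re h

theorem apply_vertex_nonneg (v : Λ.Vertex) : 0 ≤ (φ (t (.vertex v))).re := by
  have h := hφ.1.nonneg (t (.vertex v))
  rw [isTCKFamily_t.star_mul_self] at h
  exact (Complex.nonneg_iff.1 h).1

theorem apply_vertex_mul_rangeProj_single [Fintype Λ.Vertex] (v : Λ.Vertex) (i : Fin k) :
    φ (t (.vertex v) * rangeProj t (Pi.single i 1)) =
      ((Real.exp (-(β * r i)) *
        (Λ.vertexMatrix i).mulVec (fun w => (φ (t (.vertex w))).re) v : ℝ) : ℂ) := by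
  classical
  have hT := isTCKFamily_t (Λ := Λ)
  rw [hT.vertex_mul_rangeProj, map_sum, ← sum_pathsTo_source, Finset.mul_sum, Complex.ofReal_sum]
  refine Finset.sum_congr rfl fun μ hμ => ?_
  have h := kms_apply_conj hφ (.rangeProj r 0) μ
  rw [hT.mul_rangeProj_zero, hT.rangeProj_zero_mul, kms_apply_vertex hφ] at h
  rw [h, (mem_pathsTo.1 hμ).2, Complex.ofReal_mul]
  congr 5
  rw [Finset.sum_eq_single i] <;> simp +contextual

/-- If `φ` does not see the defect of the Cuntz-Krieger relation in the degrees `e_i`, then it does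
not see it in any degree. -/
theorem apply_vertex_mul_rangeProj [Fintype Λ.Vertex]
    (h : ∀ i, (Λ.vertexMatrix i).mulVec (fun w => (φ (t (.vertex w))).re) =
      Real.exp (β * r i) • fun w => (φ (t (.vertex w))).re) (n : Fin k → ℕ) (v : Λ.Vertex) :
    φ (t (.vertex v) * rangeProj t n) = φ (t (.vertex v)) := by
  have hT := isTCKFamily_t (Λ := Λ)
  have h1 : ∀ i v, φ (t (.vertex v) * rangeProj t (Pi.single i 1)) = φ (t (.vertex v)) := by
    intro i v
    rw [apply_vertex_mul_rangeProj_single hφ, h, kms_apply_vertex hφ v, Pi.smul_apply, smul_eq_mul,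
      ← mul_assoc, ← Real.exp_add, neg_add_cancel, Real.exp_zero, one_mul]
  generalize hN : ∑ j, n j = N
  induction N generalizing n with
  | zero =>
    obtain rfl : n = 0 := funext fun j =>
      (Finset.sum_eq_zero_iff.1 hN) j (Finset.mem_univ j)
    rw [hT.vertex_mul_rangeProj_zero]
  | succ N ih =>
    obtain ⟨i, hi⟩ : ∃ i, n i ≠ 0 := by
      by_contra! h0
      simp [h0] at hN
    have hle : Pi.single i 1 ≤ n := by
      intro j
      by_cases hj : j = i
      · subst hj; simpa using Nat.one_le_iff_ne_zero.2 hi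
      · simp [hj]
    obtain ⟨n', rfl⟩ : ∃ n' : Fin k → ℕ, n = n' + Pi.single i 1 :=
      ⟨_, (tsub_add_cancel_of_le hle).symm⟩
    have hN' : ∑ j, n' j = N := by
      simp only [Pi.add_apply, Finset.sum_add_distrib, Finset.sum_pi_single', Finset.mem_univ,
        if_true] at hN
      omega
    have h2 : ∀ μ : Λ.Path, φ (t μ * rangeProj t (Pi.single i 1) * star (t μ)) =
        φ (t μ * star (t μ)) := fun μ => by
      have h3 := kms_apply_conj hφ (.rangeProj r 0) μ
      rw [hT.mul_rangeProj_zero, hT.rangeProj_zero_mul] at h3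
      rw [h3, kms_apply_conj hφ (.rangeProj r _), ← hT.vertex_mul_rangeProj_comm, h1]
    rw [← ih n' hN', ← hT.sum_mul_rangeProj_mul_star, hT.vertex_mul_sum_mul_star, map_sum,
      hT.vertex_mul_rangeProj, map_sum]
    exact Finset.sum_congr rfl fun μ _ => h2 μ

end KMS

end KGraph

/-! ### A small GNS representation -/

/-- An orthonormal family in a separable inner product space is countable, since the balls of
radius `1 / 2` around its members are disjoint. -/
theorem Orthonormal.countable_index {E ι : Type*} [NormedAddCommGroup E] [InnerProductSpace ℂ E]
    [TopologicalSpace.SeparableSpace E] {v : ι → E} (hv : Orthonormal ℂ v) : Countable ι := by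
  rw [← Set.countable_univ_iff]
  refine Set.PairwiseDisjoint.countable_of_isOpen (s := fun i => Metric.ball (v i) (1 / 2))
    ?_ (fun i _ => Metric.isOpen_ball) fun i _ => ⟨v i, by simp⟩
  intro i _ j _ hij
  refine Metric.ball_disjoint_ball ?_
  have h : ‖v i - v j‖ ^ 2 = 2 := by
    rw [norm_sub_sq (𝕜 := ℂ), hv.2 hij, hv.1, hv.1]
    norm_num
  rw [dist_eq_norm]
  nlinarith [norm_nonneg (v i - v j)]

/-- A separable Hilbert space is isometric to some `ℓ²(ι)` with `ι` in any given universe. -/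
theorem exists_linearIsometryEquiv_l2 (E : Type*) [NormedAddCommGroup E] [InnerProductSpace ℂ E]
    [CompleteSpace E] [TopologicalSpace.SeparableSpace E] :
    ∃ ι : Type u, Nonempty (E ≃ₗᵢ[ℂ] lp (fun _ : ι => ℂ) 2) := by
  obtain ⟨w, b, -⟩ := exists_hilbertBasis ℂ E
  have : Countable w := b.orthonormal.countable_index
  have : Small.{u} w := Countable.toSmall w
  let e := (equivShrink.{u} w).symm
  have hb : Orthonormal ℂ (b ∘ e) := b.orthonormal.comp e e.injective
  have hr : Set.range (b ∘ e) = Set.range b := e.surjective.range_comp b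
  exact ⟨Shrink.{u} w, ⟨(HilbertBasis.mk hb (by rw [hr, b.dense_span])).repr⟩⟩

/-- The GNS representation of a state of a separable C⋆-algebra, on a Hilbert space in any given
universe: the completion of `A` is separable, hence isometric to `ℓ²(ι)` for a countable `ι`.  The
vector `ξ a` is the class of `a`. -/
theorem IsCStarState.exists_gns {A : Type*} [NonUnitalCStarAlgebra A]
    [TopologicalSpace.SeparableSpace A] {φ : A →L[ℂ] ℂ} (hφ : IsCStarState φ) :
    ∃ (ι : Type u) (ρ : A →⋆ₙₐ[ℂ] (lp (fun _ : ι => ℂ) 2 →L[ℂ] lp (fun _ : ι => ℂ) 2))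
      (ξ : A → lp (fun _ : ι => ℂ) 2), DenseRange ξ ∧ (∀ a b, ρ a (ξ b) = ξ (a * b)) ∧
      ∀ a b, inner ℂ (ξ a) (ξ b) = φ (star a * b) := by
  let _ := CStarAlgebra.spectralOrder A
  have := CStarAlgebra.spectralOrderedRing A
  let f := hφ.toPositiveLinearMap
  let η : A → f.GNS := fun a => (f.toPreGNS a : f.GNS)
  have hη : ∀ a b, inner ℂ (η a) (η b) = φ (star a * b) := fun a b =>
    UniformSpace.Completion.inner_coe _ _
  have hdense : DenseRange η :=
    UniformSpace.Completion.denseRange_coe.comp f.toPreGNS.surjective.denseRange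
      (UniformSpace.Completion.continuous_coe _)
  have hcont : Continuous η := by
    refine (UniformSpace.Completion.continuous_coe _).comp ?_
    refine AddMonoidHomClass.continuous_of_bound f.toPreGNS.toLinearMap 1 fun a => ?_
    refine abs_le_of_sq_le_sq' ?_ (by positivity) |>.2
    have h := congrArg norm (f.preGNS_norm_sq (f.toPreGNS a))
    have h1 : ‖f.toPreGNS a‖ ^ 2 = ‖f (star a * a)‖ := by simpa using h
    have h2 := φ.le_opNorm (star a * a)
    rw [hφ.norm_eq_one, CStarRing.norm_star_mul_self] at h2
    rw [one_mul, sq ‖a‖, ← one_mul (‖a‖ * ‖a‖)]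
    exact h1.trans_le h2
  have : TopologicalSpace.SeparableSpace f.GNS := hdense.separableSpace hcont
  obtain ⟨ι, ⟨U⟩⟩ := exists_linearIsometryEquiv_l2.{u} f.GNS
  let ρ : A →⋆ₙₐ[ℂ] (lp (fun _ : ι => ℂ) 2 →L[ℂ] lp (fun _ : ι => ℂ) 2) :=
    { toFun a := U.conjStarAlgEquiv (f.gnsNonUnitalStarAlgHom a)
      map_smul' c a := (congrArg _ (map_smul _ c a)).trans (map_smul U.conjStarAlgEquiv c _)
      map_zero' := (congrArg _ (map_zero _)).trans (map_zero U.conjStarAlgEquiv)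
      map_add' a b := (congrArg _ (map_add _ a b)).trans (map_add U.conjStarAlgEquiv _ _)
      map_mul' a b := (congrArg _ (map_mul _ a b)).trans (map_mul U.conjStarAlgEquiv _ _)
      map_star' a := (congrArg _ (map_star _ a)).trans (map_star U.conjStarAlgEquiv _) }
  refine ⟨ι, ρ, fun a => U (η a),
    U.surjective.denseRange.comp hdense U.continuous, fun a b => ?_, fun a b => ?_⟩
  · change U (f.gnsNonUnitalStarAlgHom a (U.symm (U (η b)))) = U (η (a * b))
    rw [U.symm_apply_apply]
    exact congrArg U f.gnsNonUnitalStarAlgHom_apply_coe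
  · rw [U.inner_map_map, hη]

/-- A unit vector in a representation space defines a vector state, provided that it is fixed by
some contraction in the algebra. -/
theorem exists_vectorState {A H : Type*} [NonUnitalCStarAlgebra A] [NormedAddCommGroup H]
    [InnerProductSpace ℂ H] [CompleteSpace H] (ρ : A →⋆ₙₐ[ℂ] (H →L[ℂ] H)) (ξ : H) (hξ : ‖ξ‖ = 1)
    (p : A) (hp : ‖p‖ ≤ 1) (hpξ : ρ p ξ = ξ) :
    ∃ ψ : A →L[ℂ] ℂ, IsCStarState ψ ∧ ∀ a, ψ a = inner ℂ ξ (ρ a ξ) := by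
  let ψ : A →L[ℂ] ℂ := LinearMap.mkContinuous
    { toFun x := inner ℂ ξ (ρ x ξ)
      map_add' x y := by rw [map_add, add_apply, inner_add_right]
      map_smul' c x := by
        rw [map_smul, smul_apply, inner_smul_right, RingHom.id_apply,
          smul_eq_mul] } 1 fun x => by
    calc ‖inner ℂ ξ (ρ x ξ)‖ ≤ ‖ξ‖ * ‖ρ x ξ‖ := norm_inner_le_norm _ _
      _ ≤ ‖ξ‖ * (‖ρ x‖ * ‖ξ‖) := by gcongr; exact (ρ x).le_opNorm _
      _ ≤ 1 * ‖x‖ := by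
        rw [hξ, one_mul, mul_one, one_mul]
        exact NonUnitalStarAlgHom.norm_apply_le ρ x
  have hψ : ∀ a, ψ a = inner ℂ ξ (ρ a ξ) := fun a => rfl
  refine ⟨ψ, ⟨fun x => ?_, le_antisymm (LinearMap.mkContinuous_norm_le _ zero_le_one _) ?_⟩, hψ⟩
  · rw [hψ, map_mul, map_star, ContinuousLinearMap.star_eq_adjoint, mul_apply_eq_comp,
      ContinuousLinearMap.adjoint_inner_right, inner_self_eq_norm_sq_to_K]
    rw [← RCLike.ofReal_pow]
    exact RCLike.ofReal_nonneg.2 (sq_nonneg _)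
  · have h1 := ψ.le_opNorm p
    rw [hψ, hpξ, inner_self_eq_norm_sq_to_K, hξ] at h1
    norm_num at h1
    nlinarith [norm_nonneg ψ]

/-! ### Factorisation through the graph algebra -/

namespace KGraph

variable {k : ℕ} {Λ : KGraph.{u} k} [Λ.IsFinite]

theorem IsTCKFamily.map {B C : Type*} [NonUnitalCStarAlgebra B] [NonUnitalCStarAlgebra C]
    {T : Λ.Path → B} (hT : IsTCKFamily T) (f : B →⋆ₙₐ[ℂ] C) : IsTCKFamily fun μ => f (T μ) where
  partialIsometry μ := by rw [← map_star, ← map_mul, ← map_mul, hT.partialIsometry]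
  projection v := (hT.projection v).map f
  orthogonal v w h := by rw [← map_mul, hT.orthogonal v w h, map_zero]
  map_comp μ ν h := by rw [← map_mul, hT.map_comp]
  star_mul_self μ := by rw [← map_star, ← map_mul, hT.star_mul_self]
  sum_le v n := by
    obtain ⟨c, hc⟩ := hT.sum_le v n
    refine ⟨f c, ?_⟩
    rw [← map_star, ← map_mul, ← hc, map_sub, map_sum]
    simp only [map_mul, map_star]
  star_mul μ ν := by
    rw [← map_star, ← map_mul, hT.star_mul, map_sum]
    simp only [map_mul, map_star]

section KMS

variable {r : Fin k → ℝ} {β : ℝ} {φ : Λ.Toeplitz →L[ℂ] ℂ} (hφ : IsKMSState (Λ.dynamics r) β φ)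

include hφ

/-- The left kernel of `φ` absorbs multiplication from the right: for homogeneous `a` the KMS
condition turns `φ(a⋆ (x⋆ x a))` into a multiple of `φ(x⋆ x a a⋆)`, which vanishes by
Cauchy-Schwarz. -/
theorem kms_leftKernel_mul {x : Λ.Toeplitz} (hx : IsHomogeneous r 0 x)
    (h : φ (star x * x) = 0) (y z : Λ.Toeplitz) : φ (star (x * y) * z) = 0 := by
  revert z
  have hsub : ∀ y ∈ Λ.spanMulStar, ∀ z, φ (star (x * y) * z) = 0 := by
    intro y hy
    induction hy using Submodule.span_induction with
    | mem y hy =>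
      obtain ⟨p, rfl⟩ := hy
      have ha := (IsHomogeneous.t r p.1).mul (IsHomogeneous.t r p.2).star
      refine hφ.1.apply_star_mul_eq_zero ?_
      dsimp only at ha ⊢
      rw [StarMul.star_mul, mul_assoc, hφ.apply_mul ha.star (hx.star.mul (hx.mul ha)), mul_assoc,
        hφ.1.apply_star_mul_eq_zero h, mul_zero]
    | zero => simp
    | add a b _ _ ha hb => intro z; rw [mul_add, star_add, add_mul, map_add, ha, hb, add_zero]
    | smul c a _ ha =>
      intro z
      rw [mul_smul_comm, star_smul, smul_mul_assoc, map_smul, ha, smul_zero]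
  have hcl : IsClosed {y : Λ.Toeplitz | ∀ z, φ (star (x * y) * z) = 0} := by
    rw [Set.ofPred_forall]
    exact isClosed_iInter fun z => isClosed_eq (by fun_prop) continuous_const
  exact closure_minimal hsub hcl (mem_closure_spanMulStar y)

/-- If `φ` does not see the defects of the Cuntz-Krieger relations, then its GNS representation
carries a Cuntz-Krieger family, and hence `φ` is a vector state of a representation of `C⋆(Λ)`. -/
theorem factors_of_apply_rangeProj [Fintype Λ.Vertex]
    (h : ∀ (n : Fin k → ℕ) v, φ (t (.vertex v) * rangeProj t n) = φ (t (.vertex v))) :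
    ∃ ψ : Λ.GraphAlg →L[ℂ] ℂ, IsCStarState ψ ∧ ∀ a, φ a = ψ (Λ.toGraphAlg a) := by
  have hT := isTCKFamily_t (Λ := Λ)
  -- `TCKRep` only admits C⋆-algebras in the universe of `Λ`, one level below `Λ.Toeplitz`.
  obtain ⟨ι, ρ, ξ, hξ, hρ, hinner⟩ := IsCStarState.exists_gns.{u} hφ.1
  have hker : ∀ x, (∀ y, φ (star (x * y) * (x * y)) = 0) → ρ x = 0 := fun x hx => by
    refine ContinuousLinearMap.coeFn_injective (hξ.equalizer (ρ x).continuous continuous_const ?_)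
    funext y
    have := hinner (x * y) (x * y)
    rw [hx, inner_self_eq_zero] at this
    exact (hρ x y).trans this
  let R : Λ.TCKRep :=
    { B := lp (fun _ : ι => ℂ) 2 →L[ℂ] lp (fun _ : ι => ℂ) 2
      T := fun μ => ρ (t μ)
      isTCK := hT.map ρ }
  have hR : IsCK R.T := fun v n => by
    set d : Λ.Toeplitz := t (.vertex v) - ∑ μ ∈ pathsTo v n, t μ * star (t μ) with hd
    have hd0 : IsHomogeneous r 0 d := by
      rw [hd, ← hT.vertex_mul_rangeProj]
      simpa using (IsHomogeneous.q r v).sub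
        (by simpa using (IsHomogeneous.q r v).mul (.rangeProj r n))
    have hdd : φ (star d * d) = 0 := by
      rw [hd, ← hT.defect_sq, ← hT.vertex_mul_rangeProj, map_sub, h, sub_self]
    have h0 : ρ d = 0 := hker d fun y => kms_leftKernel_mul hφ hd0 hdd _ _
    rw [hd, map_sub, sub_eq_zero, map_sum] at h0
    refine h0.trans (Finset.sum_congr rfl fun μ _ => ?_)
    rw [map_mul, map_star]
  let e := evalHom {i : Λ.TCKRep | IsCK i.T} ⟨R, hR⟩
  have he : ∀ a, e (Λ.toGraphAlg a) = ρ a :=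
    DFunLike.congr_fun (UnivAlg.hom_ext (f := e.comp Λ.toGraphAlg) (g := ρ) fun μ => rfl)
  set P : Λ.Toeplitz := rangeProj t 0 with hP
  have hPs : star P = P := star_rangeProj _ _
  have hξ0 : ‖ξ P‖ = 1 := by
    have h1 := hinner P P
    rw [hPs, rangeProj_zero_mul, hφ.1.apply_rangeProj_zero, inner_self_eq_norm_sq_to_K] at h1
    have h2 : ‖ξ P‖ ^ 2 = 1 := Complex.ofReal_injective (by simpa using h1)
    exact (pow_eq_one_iff_of_nonneg (norm_nonneg _) two_ne_zero).1 h2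
  have hp : ‖Λ.toGraphAlg P‖ ≤ 1 := IsStarProjection.norm_le _
    (IsStarProjection.map (x := P) ⟨rangeProj_zero_mul _, hPs⟩ Λ.toGraphAlg)
  obtain ⟨ψ, hψ, hψe⟩ := exists_vectorState e (ξ P) hξ0 (Λ.toGraphAlg P) hp
    (by rw [he, hρ, rangeProj_zero_mul])
  refine ⟨ψ, hψ, fun a => ?_⟩
  rw [hψe, he, hρ, hinner, hPs, ← mul_assoc, rangeProj_zero_mul, mul_rangeProj_zero]

end KMS

end KGraph

theorem proposition4p1 {k : ℕ} (Λ : KGraph.{u} k) [Λ.IsFinite] [Fintype Λ.Vertex]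
    [DecidableEq Λ.Vertex] (hΛ : Λ.NoSources) (r : Fin k → ℝ) (hr : ∀ i, 0 < r i)
    (β : ℝ) (hβ : 0 ≤ β) (φ : Λ.Toeplitz →L[ℂ] ℂ) (hφ : IsKMSState (Λ.dynamics r) β φ) :
    ∃ m : Λ.Vertex → ℝ,
      (∀ v, φ (KGraph.q v) = (m v : ℂ)) ∧
      ((∀ v, m v ∈ Set.Icc (0 : ℝ) 1) ∧ ∑ v, m v = 1) ∧
      (∀ K : Finset (Fin k), 0 ≤ Matrix.mulVec (Λ.subinvarianceProd r β K) m) ∧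
      ((∃ ψ : Λ.GraphAlg →L[ℂ] ℂ, IsCStarState ψ ∧ ∀ a, φ a = ψ (Λ.toGraphAlg a)) ↔
        ∀ i, Matrix.mulVec (Λ.vertexMatrix i) m = Real.exp (β * r i) • m) := by
  refine ⟨fun v => (φ (KGraph.t (.vertex v))).re, KGraph.kms_apply_vertex hφ,
    ⟨fun v => ⟨KGraph.apply_vertex_nonneg hφ v, ?_⟩, KGraph.sum_apply_vertex hφ⟩,
    KGraph.subinvariance hφ, ?_, fun h => KGraph.factors_of_apply_rangeProj hφ
      (KGraph.apply_vertex_mul_rangeProj hφ h)⟩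
  · rw [← KGraph.sum_apply_vertex hφ]
    exact Finset.single_le_sum (f := fun v => (φ (KGraph.t (.vertex v))).re)
      (fun w _ => KGraph.apply_vertex_nonneg hφ w) (Finset.mem_univ v)
  · rintro ⟨ψ, -, hψ⟩ i
    funext v
    have h0 : Λ.toGraphAlg (KGraph.t (.vertex v) * KGraph.rangeProj KGraph.t (Pi.single i 1)) =
        Λ.toGraphAlg (KGraph.t (.vertex v)) := by
      rw [KGraph.isTCKFamily_t.vertex_mul_rangeProj, map_sum]
      refine Eq.trans (Finset.sum_congr rfl fun μ _ => ?_)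
        (KGraph.isCK_univGen v (Pi.single i 1)).symm
      rw [map_mul, map_star]
      rfl
    have h1 := KGraph.apply_vertex_mul_rangeProj_single hφ v i
    rw [hψ, h0, ← hψ, KGraph.kms_apply_vertex hφ, Complex.ofReal_inj] at h1
    rw [Pi.smul_apply, smul_eq_mul, h1, ← mul_assoc, ← Real.exp_add, add_neg_cancel,
      Real.exp_zero, one_mul]
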